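/- Let $T,\rho,c,\gamma_0>0$ and $m\ge 0$, let $w$ be a standard real Brownian motion on a filtered probability space $(\Omega,\mathcal F,(\mathcal F_t)_{t\in[0,T]},\mathbb P)$, and let $\sigma:\mathbb R^2\to\mathbb R$ be Lipschitz continuous. Let $\mathfrak U$ be the set of measurable adapted processes $u=(u_t)_{t\in[0,T]}$ with values in $U=[0,m]$. For $s\in[0,T]$, $x\in\mathbb R$ and $u\in\mathfrak U$ let $(x_t)_{t\in[s,T]}$ be the continuous square-integrable solution of $$x_t=x+\int_s^t(-\rho x_r+u_r)\,dr+\int_s^t\sigma(x_r,u_r)\,dw_r,\qquad s\le t\le T,$$ and put, with $\gamma=\gamma_0e^{-cT}$, $$v^u(s,x)=\mathbb E\Big[\gamma x_T-\int_s^Te^{-ct}u_t\,dt\Big],\qquad v(s,x)=\sup_{u\in\mathfrak U}v^u(s,x).$$ Let $$t_*=\frac{\rho T-\log\gamma}{\rho+c},\qquad \gamma(t)=\gamma e^{-\rho(T-t)},\qquad b_1(t)=\frac{m\gamma}{\rho}\big(1-e^{-\rho(T-t)}\big)+\frac mc\big(e^{-cT}-e^{-ct}\big),$$ $$u_*(t)=\begin{cases}0,&t\le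 t_*,\\ m,&t>t_*,\end{cases}\qquad b(t)=\begin{cases}b_1(\min(t_*,T)),&t\le t_*,\\ b_1(t),&t>t_*.\end{cases}$$ Then the expectation defining $v^u(s,x)$ is that of an integrable random variable for every $u\in\mathfrak U$; the deterministic bang-bang control $u_*$ belongs to $\mathfrak U$, its state equation has a solution from every $(0,x)$, and $u_*$ maximizes $v^u(0,x)$ over $u\in\mathfrak U$, for every $x\in\mathbb R$; and $$v(t,x)=\gamma(t)\,x+b(t)\qquad\text{for all }t\in[0,T],\ x\in\mathbb R.$$ The value function is the same if the cost in $v^u(s,x)$ is accumulated over $[0,T]$ instead of $[s,T]$. -/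

import Mathlib

open MeasureTheory ProbabilityTheory Filter Set
open scoped Topology ENNReal

noncomputable section

namespace Goodwill

variable {Ω : Type*} [mΩ : MeasurableSpace Ω]

/-- `W` is a standard real Brownian motion on `[0, T]` relative to the filtration `F` under `P`. -/
structure IsBrownianOn (P : Measure Ω) (F : Filtration ℝ mΩ) (T : ℝ) (W : ℝ → Ω → ℝ) : Prop where
  adapted : ∀ t ∈ Icc 0 T, Measurable[F t] (W t)
  zero : ∀ᵐ ω ∂P, W 0 ω = 0
  continuous : ∀ᵐ ω ∂P, ContinuousOn (fun t => W t ω) (Icc 0 T)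
  law : ∀ s t, 0 ≤ s → s ≤ t → t ≤ T →
    HasLaw (fun ω => W t ω - W s ω) (gaussianReal 0 (t - s).toNNReal) P
  indep : ∀ s t, 0 ≤ s → s ≤ t → t ≤ T →
    Indep (MeasurableSpace.comap (fun ω => W t ω - W s ω) inferInstance) (F s) P

/-- A real process `H` is jointly measurable on `[a, b] × Ω` and adapted to `F` on `[a, b]`. -/
structure IsMeasurableAdapted (F : Filtration ℝ mΩ) (a b : ℝ) (H : ℝ → Ω → ℝ) : Prop where
  measurable : Measurable (fun p : Icc a b × Ω => H p.1 p.2)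
  adapted : ∀ t ∈ Icc a b, Measurable[F t] (H t)

/-- Elementary processes on `[a, b]`: the process `∑_{i < n} ξ i * 1_{(τ i, τ (i+1)]}` with
deterministic times `a ≤ τ 0 ≤ τ 1 ≤ … ≤ b` and bounded, `F (τ i)`-measurable coefficients. -/
structure ElementaryProcess (F : Filtration ℝ mΩ) (a b : ℝ) where
  n : ℕ
  τ : ℕ → ℝ
  mono : Monotone τ
  mem : ∀ i, τ i ∈ Icc a b
  ξ : ℕ → Ω → ℝ
  meas : ∀ i, Measurable[F (τ i)] (ξ i)
  bdd : ∃ C : ℝ, ∀ i ω, |ξ i ω| ≤ C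

/-- The value at time `t` of an elementary process. -/
def ElementaryProcess.path {F : Filtration ℝ mΩ} {a b : ℝ} (S : ElementaryProcess F a b)
    (t : ℝ) (ω : Ω) : ℝ :=
  ∑ i ∈ Finset.range S.n, (Ioc (S.τ i) (S.τ (i + 1))).indicator (fun _ => S.ξ i ω) t

/-- The stochastic integral `∑_{i < n} ξ i * (W (τ (i+1)) - W (τ i))` of an elementary process. -/
def ElementaryProcess.integral {F : Filtration ℝ mΩ} {a b : ℝ} (S : ElementaryProcess F a b)
    (W : ℝ → Ω → ℝ) (ω : Ω) : ℝ :=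
  ∑ i ∈ Finset.range S.n, S.ξ i ω * (W (S.τ (i + 1)) ω - W (S.τ i) ω)

/-- `Z` is (a version of) the Itô integral `∫_a^b H dW`: there are elementary processes converging
to `H` in `L²([a, b] × Ω)` whose stochastic integrals converge to `Z` in `L²(Ω)`. -/
def IsItoIntegral (P : Measure Ω) (F : Filtration ℝ mΩ) (W : ℝ → Ω → ℝ) (a b : ℝ)
    (H : ℝ → Ω → ℝ) (Z : Ω → ℝ) : Prop :=
  MemLp Z 2 P ∧ ∃ S : ℕ → ElementaryProcess F a b,
    Tendsto (fun k => ∫⁻ ω, (∫⁻ t in Icc a b, ‖H t ω - (S k).path t ω‖ₑ ^ 2) ∂P) atTop (𝓝 0) ∧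
    Tendsto (fun k => ∫⁻ ω, ‖Z ω - (S k).integral W ω‖ₑ ^ 2 ∂P) atTop (𝓝 0)

/-- Admissible controls: measurable, adapted processes on `[0, T]` with values in `[0, m]`. -/
structure IsControl (F : Filtration ℝ mΩ) (T m : ℝ) (u : ℝ → Ω → ℝ) : Prop where
  measAdapted : IsMeasurableAdapted F 0 T u
  mem : ∀ t ∈ Icc 0 T, ∀ ω, u t ω ∈ Icc 0 m

/-- `X` is the goodwill process started from `x` at time `s` and driven by the control `u`, i.e.
the continuous square-integrable solution on `[s, T]` of
`dX = (-ρ X + u) dt + σ(X, u) dW`, `X_s = x`. -/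
structure IsState (P : Measure Ω) (F : Filtration ℝ mΩ) (W : ℝ → Ω → ℝ) (T ρ : ℝ)
    (σ : ℝ × ℝ → ℝ) (s x : ℝ) (u X : ℝ → Ω → ℝ) : Prop where
  measAdapted : IsMeasurableAdapted F s T X
  continuous : ∀ᵐ ω ∂P, ContinuousOn (fun t => X t ω) (Icc s T)
  sqIntegrable : ∫⁻ ω, (∫⁻ t in Icc s T, ‖X t ω‖ₑ ^ 2) ∂P < ∞
  equation : ∀ t ∈ Icc s T, ∃ Z : Ω → ℝ,
    IsItoIntegral P F W s t (fun r ω => σ (X r ω, u r ω)) Z ∧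
    ∀ᵐ ω ∂P, X t ω = x + (∫ r in s..t, (-ρ * X r ω + u r ω)) + Z ω

/-- Terminal reward `γ X_T` minus the discounted cost of the control accumulated over `[a, T]`. -/
def reward (T c γ a : ℝ) (u X : ℝ → Ω → ℝ) (ω : Ω) : ℝ :=
  γ * X T ω - ∫ t in a..T, Real.exp (-c * t) * u t ω

/-- The performance functional: the expectation of the reward. -/
def performance (P : Measure Ω) (T c γ a : ℝ) (u X : ℝ → Ω → ℝ) : ℝ :=
  ∫ ω, reward T c γ a u X ω ∂P

/-- All values of the performance functional over admissible controls, the goodwill being started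
from `x` at time `s` and the cost being accumulated over `[a, T]`. -/
def performanceValues (P : Measure Ω) (F : Filtration ℝ mΩ) (W : ℝ → Ω → ℝ) (T ρ c γ m : ℝ)
    (σ : ℝ × ℝ → ℝ) (a s x : ℝ) : Set ℝ :=
  {J | ∃ u X : ℝ → Ω → ℝ, IsControl F T m u ∧ IsState P F W T ρ σ s x u X ∧
    J = performance P T c γ a u X}

/-- The switching time `t_*`. -/
def switchTime (T ρ c γ : ℝ) : ℝ := (ρ * T - Real.log γ) / (ρ + c)

/-- The bang-bang policy: `0` up to and including `t_*`, and `m` afterwards. -/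
def bangBang (T ρ c γ m t : ℝ) : ℝ := if t ≤ switchTime T ρ c γ then 0 else m

/-- The slope `γ(t)` of the value function. -/
def slope (T ρ γ t : ℝ) : ℝ := γ * Real.exp (-ρ * (T - t))

/-- The function `b_1`. -/
def b₁ (T ρ c γ m t : ℝ) : ℝ :=
  m * γ / ρ * (1 - Real.exp (-ρ * (T - t))) + m / c * (Real.exp (-c * T) - Real.exp (-c * t))

/-- The intercept `b(t)` of the value function. -/
def intercept (T ρ c γ m t : ℝ) : ℝ :=
  if t ≤ switchTime T ρ c γ then b₁ T ρ c γ m (min (switchTime T ρ c γ) T) else b₁ T ρ c γ m t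

end Goodwill

end

/-! The noise disappears on taking expectations. An Itô integral has mean zero, so `E X_t` solves
the linear equation with drift `-ρ E X_t + E u_t`, and variation of constants gives `E X_T`. Hence
the performance equals `γ(s) x + ∫_s^T (γ e^{-ρ(T-t)} - e^{-ct}) E u_t dt`, minus the cost spent on
`[a, s]` when accumulation starts at `a < s` (`IsState.performance_eq`). The mean `E u_t` lies in
`[0, m]` and the factor `netGain` changes sign exactly at `t_*`, so the integral is maximized
pointwise by `0` before `t_*` and `m` after it (`netGain_mul_le`). Its maximum is `b(s)`
(`integral_netGain_mul_bangBang`). Control before `s` only costs, so waiting until `s` is optimal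
there and the starting time of the cost does not matter.

The value is attained only if the state equation has a solution for the optimal control, and this
existence is proved rather than assumed. Only controls jumping from `0` to `m` at a deterministic
time are needed. Euler schemes are run on nested grids that contain the jump. Itô's isometry and a
discrete Gronwall inequality make successive schemes differ by `O(2^{-n})` in mean square. Doob's
maximal inequality and Borel–Cantelli then give almost sure uniform convergence to a continuous
limit, and truncating the coefficients of the schemes yields elementary processes that exhibit its
martingale part as an Itô integral (`StepGrid.isItoIntegral_limit`). Uniqueness of solutions is
never needed, because the performance depends only on the mean of the control. -/

noncomputable section

namespace Goodwill

/-! ### Brownian increments and the mean of an Itô integral -/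

section

variable {Ω : Type*} [mΩ : MeasurableSpace Ω]

variable {P : Measure Ω} {F : Filtration ℝ mΩ} {T : ℝ} {W : ℝ → Ω → ℝ}

namespace IsBrownianOn

lemma memLp_increment (hW : IsBrownianOn P F T W) {s t : ℝ} (hs : 0 ≤ s) (hst : s ≤ t)
    (ht : t ≤ T) : MemLp (fun ω => W t ω - W s ω) 2 P := by
  have h := hW.law s t hs hst ht
  have h2 := memLp_id_gaussianReal' (μ := 0) (v := (t - s).toNNReal) 2 (by simp)
  rw [← h.map_eq] at h2
  exact (memLp_map_measure_iff aestronglyMeasurable_id h.aemeasurable).1 h2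

lemma integral_increment (hW : IsBrownianOn P F T W) {s t : ℝ} (hs : 0 ≤ s) (hst : s ≤ t)
    (ht : t ≤ T) : ∫ ω, (W t ω - W s ω) ∂P = 0 := by
  rw [(hW.law s t hs hst ht).integral_eq, integral_id_gaussianReal]

lemma integral_increment_sq (hW : IsBrownianOn P F T W) {s t : ℝ} (hs : 0 ≤ s) (hst : s ≤ t)
    (ht : t ≤ T) : ∫ ω, (W t ω - W s ω) ^ 2 ∂P = t - s := by
  have h := (hW.law s t hs hst ht).variance_eq
  rw [variance_id_gaussianReal, variance_of_integral_eq_zero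
    (hW.law s t hs hst ht).aemeasurable (hW.integral_increment hs hst ht)] at h
  simpa [Real.coe_toNNReal _ (sub_nonneg.2 hst)] using h

lemma indepFun_increment (hW : IsBrownianOn P F T W) {s t : ℝ} (hs : 0 ≤ s) (hst : s ≤ t)
    (ht : t ≤ T) {B : Ω → ℝ} (hB : Measurable[F s] B) :
    IndepFun B (fun ω => W t ω - W s ω) P := by
  rw [IndepFun_iff_Indep]
  exact indep_of_indep_of_le_left (hW.indep s t hs hst ht).symm hB.comap_le

lemma measurable_increment (hW : IsBrownianOn P F T W) {s t : ℝ} (hs : 0 ≤ s) (hst : s ≤ t)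
    (ht : t ≤ T) : Measurable[F t] (fun ω => W t ω - W s ω) :=
  (hW.adapted t ⟨hs.trans hst, ht⟩).sub
    ((hW.adapted s ⟨hs, hst.trans ht⟩).mono (F.mono hst) le_rfl)

/-- By independence the square is a product of independent integrable variables, so no bound on `B`
is required. The Euler coefficients used later are only square integrable. -/
lemma memLp_mul_increment (hW : IsBrownianOn P F T W) {s t : ℝ} (hs : 0 ≤ s)
    (hst : s ≤ t) (ht : t ≤ T) {B : Ω → ℝ} (hB : Measurable[F s] B) (hB2 : MemLp B 2 P) :
    MemLp (fun ω => B ω * (W t ω - W s ω)) 2 P := by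
  have hm := (hW.measurable_increment hs hst ht).mono (F.le t) le_rfl
  have hi := (hW.indepFun_increment hs hst ht hB).comp (φ := fun x : ℝ => x ^ 2)
    (ψ := fun x : ℝ => x ^ 2) (by fun_prop) (by fun_prop)
  refine (memLp_two_iff_integrable_sq (f := fun ω => B ω * (W t ω - W s ω)) ((hB.mono (F.le s) le_rfl).mul hm).aestronglyMeasurable).2 ?_
  have := hi.integrable_mul hB2.integrable_sq (hW.memLp_increment hs hst ht).integrable_sq
  refine this.congr (ae_of_all _ fun ω => ?_)
  simp [mul_pow]

/-- The mean of a product of independent variables factors under mere measurability. This allows `B`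
to be a product of two square integrable variables in the isometry. -/
lemma integral_mul_increment (hW : IsBrownianOn P F T W) {s t : ℝ} (hs : 0 ≤ s)
    (hst : s ≤ t) (ht : t ≤ T) {B : Ω → ℝ} (hB : Measurable[F s] B) :
    ∫ ω, B ω * (W t ω - W s ω) ∂P = 0 := by
  have hm := (hW.measurable_increment hs hst ht).mono (F.le t) le_rfl
  rw [(hW.indepFun_increment hs hst ht hB).integral_fun_mul_eq_mul_integral
    (hB.mono (F.le s) le_rfl).aestronglyMeasurable hm.aestronglyMeasurable,
    hW.integral_increment hs hst ht, mul_zero]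

lemma integral_mul_increment_sq (hW : IsBrownianOn P F T W) {s t : ℝ} (hs : 0 ≤ s)
    (hst : s ≤ t) (ht : t ≤ T) {B : Ω → ℝ} (hB : Measurable[F s] B) :
    ∫ ω, (B ω * (W t ω - W s ω)) ^ 2 ∂P = (t - s) * ∫ ω, B ω ^ 2 ∂P := by
  have hm := (hW.measurable_increment hs hst ht).mono (F.le t) le_rfl
  have hi := (hW.indepFun_increment hs hst ht hB).comp (φ := fun x : ℝ => x ^ 2)
    (ψ := fun x : ℝ => x ^ 2) (by fun_prop) (by fun_prop)
  have := hi.integral_fun_mul_eq_mul_integral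
    ((hB.mono (F.le s) le_rfl).pow_const 2).aestronglyMeasurable
    (hm.pow_const 2).aestronglyMeasurable
  simp only [Function.comp_apply] at this
  simp_rw [mul_pow]
  rw [this, hW.integral_increment_sq hs hst ht, mul_comm]

/-- One step of the Itô isometry. -/
lemma integral_add_mul_increment_sq (hW : IsBrownianOn P F T W) {s t : ℝ} (hs : 0 ≤ s)
    (hst : s ≤ t) (ht : t ≤ T) {A B : Ω → ℝ} (hA : Measurable[F s] A) (hA2 : MemLp A 2 P)
    (hB : Measurable[F s] B) (hB2 : MemLp B 2 P) :
    ∫ ω, (A ω + B ω * (W t ω - W s ω)) ^ 2 ∂P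
      = ∫ ω, A ω ^ 2 ∂P + (t - s) * ∫ ω, B ω ^ 2 ∂P := by
  have hBW := hW.memLp_mul_increment hs hst ht hB hB2
  have hcross : Integrable (fun ω => A ω * (B ω * (W t ω - W s ω))) P :=
    hA2.integrable_mul hBW
  -- The cross term vanishes because `A * B` is still known at time `s`.
  have h0 : ∫ ω, A ω * (B ω * (W t ω - W s ω)) ∂P = 0 := by
    simpa [mul_assoc] using hW.integral_mul_increment hs hst ht (hA.mul hB)
  rw [← hW.integral_mul_increment_sq hs hst ht hB]
  have : ∀ ω, (A ω + B ω * (W t ω - W s ω)) ^ 2 = (A ω ^ 2 + (B ω * (W t ω - W s ω)) ^ 2)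
      + 2 * (A ω * (B ω * (W t ω - W s ω))) := fun ω => by ring
  simp_rw [this]
  have hadd : Integrable (fun ω => A ω ^ 2 + (B ω * (W t ω - W s ω)) ^ 2) P :=
    hA2.integrable_sq.add hBW.integrable_sq
  rw [integral_add hadd (hcross.const_mul 2),
    integral_add hA2.integrable_sq hBW.integrable_sq, integral_const_mul, h0]
  ring

end IsBrownianOn

/-- The stochastic integral of an elementary process is square integrable. -/
lemma ElementaryProcess.memLp_integral [IsFiniteMeasure P] (hW : IsBrownianOn P F T W) {a b : ℝ}
    (ha : 0 ≤ a) (hb : b ≤ T) (S : ElementaryProcess F a b) : MemLp (S.integral W) 2 P := by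
  obtain ⟨C, hC⟩ := S.bdd
  refine memLp_finsetSum _ fun i _ => ?_
  refine hW.memLp_mul_increment (ha.trans (S.mem i).1) (S.mono i.le_succ)
    ((S.mem (i + 1)).2.trans hb) (S.meas i) ?_
  exact MemLp.of_bound ((S.meas i).mono (F.le _) le_rfl).aestronglyMeasurable C
    (ae_of_all _ fun ω => hC i ω)

lemma ElementaryProcess.integral_integral [IsFiniteMeasure P] (hW : IsBrownianOn P F T W)
    {a b : ℝ} (ha : 0 ≤ a) (hb : b ≤ T) (S : ElementaryProcess F a b) :
    ∫ ω, S.integral W ω ∂P = 0 := by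
  obtain ⟨C, hC⟩ := S.bdd
  unfold ElementaryProcess.integral
  rw [integral_finsetSum]
  · exact Finset.sum_eq_zero fun i _ => hW.integral_mul_increment (ha.trans (S.mem i).1)
      (S.mono i.le_succ) ((S.mem (i + 1)).2.trans hb) (S.meas i)
  · intro i _
    refine (hW.memLp_mul_increment (ha.trans (S.mem i).1) (S.mono i.le_succ)
      ((S.mem (i + 1)).2.trans hb) (S.meas i) ?_).integrable (by norm_num)
    exact MemLp.of_bound ((S.meas i).mono (F.le _) le_rfl).aestronglyMeasurable C
      (ae_of_all _ fun ω => hC i ω)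

lemma eLpNorm_two_eq_lintegral_rpow {μ : Measure Ω} (f : Ω → ℝ) :
    eLpNorm f 2 μ = (∫⁻ ω, ‖f ω‖ₑ ^ 2 ∂μ) ^ (1 / 2 : ℝ) := by
  rw [eLpNorm_eq_lintegral_rpow_enorm_toReal (by norm_num) (by norm_num)]
  simp

/-- `L²` convergence implies `L¹` convergence under a probability measure, and elementary integrals
have mean zero. -/
lemma IsItoIntegral.integral_eq_zero [IsProbabilityMeasure P] (hW : IsBrownianOn P F T W)
    {a b : ℝ} (ha : 0 ≤ a) (hb : b ≤ T) {H : ℝ → Ω → ℝ} {Z : Ω → ℝ}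
    (hZ : IsItoIntegral P F W a b H Z) : ∫ ω, Z ω ∂P = 0 := by
  obtain ⟨hZ2, S, -, hS⟩ := hZ
  have hlim : Tendsto (fun k => eLpNorm ((S k).integral W - Z) 1 P) atTop (𝓝 0) := by
    have h2 : Tendsto (fun k => (∫⁻ ω, ‖Z ω - (S k).integral W ω‖ₑ ^ 2 ∂P) ^ (1 / 2 : ℝ))
        atTop (𝓝 0) := by
      have := (ENNReal.continuous_rpow_const (y := 1 / 2)).tendsto 0 |>.comp hS
      simpa [Function.comp_def] using this
    refine tendsto_of_tendsto_of_tendsto_of_le_of_le tendsto_const_nhds h2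
      (fun _ => zero_le) fun k => ?_
    rw [← eLpNorm_two_eq_lintegral_rpow, eLpNorm_sub_comm]
    exact eLpNorm_le_eLpNorm_of_exponent_le (by norm_num)
      (hZ2.aestronglyMeasurable.sub ((S k).memLp_integral hW ha hb).aestronglyMeasurable)
  have := tendsto_integral_of_L1' Z hZ2.aestronglyMeasurable
    (Eventually.of_forall fun k => ((S k).memLp_integral hW ha hb).integrable (by norm_num)) hlim
  simp only [(S _).integral_integral hW ha hb] at this
  exact tendsto_nhds_unique this tendsto_const_nhds

end

/-! ### The mean of the state and a formula for the performance -/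

section

variable {Ω : Type*} [mΩ : MeasurableSpace Ω]

variable {P : Measure Ω} {F : Filtration ℝ mΩ} {T : ℝ} {W : ℝ → Ω → ℝ}

/-- Variation of constants for a scalar linear integral equation. -/
lemma eq_exp_mul_add_integral {f v : ℝ → ℝ} {ρ s b x : ℝ} (hsb : s ≤ b)
    (hf : IntervalIntegrable f volume s b) (hv : IntervalIntegrable v volume s b)
    (h : ∀ t ∈ Icc s b, f t = x + ∫ r in s..t, (-ρ * f r + v r)) :
    f b = Real.exp (-ρ * (b - s)) * x + ∫ r in s..b, Real.exp (-ρ * (b - r)) * v r := by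
  have hk : IntervalIntegrable (fun r => -ρ * f r + v r) volume s b :=
    (hf.const_mul (-ρ)).add hv
  have hE : ContDiff ℝ 1 (fun t : ℝ => Real.exp (ρ * t)) := by fun_prop
  have hEd : deriv (fun t : ℝ => Real.exp (ρ * t)) = fun t => ρ * Real.exp (ρ * t) := by
    ext t
    have : HasDerivAt (fun t : ℝ => Real.exp (ρ * t)) (Real.exp (ρ * t) * (ρ * 1)) t :=
      ((hasDerivAt_id t).const_mul ρ).exp
    rw [this.deriv]; ring
  -- Since `v` is only integrable, the primitive is absolutely continuous but need not be
  -- differentiable everywhere. The integrating factor `e^{ρt}` is therefore brought in through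
  -- integration by parts for absolutely continuous functions.
  have hparts := (hE.contDiffOn.absolutelyContinuousOnInterval
    (a := s) (b := b)).integral_mul_deriv_eq_deriv_mul
    (hk.absolutelyContinuousOnInterval_intervalIntegral (c := s) (by simp))
  have hd : ∀ᵐ t, t ∈ uIoc s b → Real.exp (ρ * t) * deriv (fun x => ∫ r in s..x,
      (-ρ * f r + v r)) t = -ρ * (Real.exp (ρ * t) * f t) + Real.exp (ρ * t) * v t := by
    filter_upwards [hk.ae_hasDerivAt_integral] with t ht hts
    rw [(ht (uIoc_subset_uIcc hts) s (by simp)).deriv]; ring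
  have hint : IntervalIntegrable (fun t => Real.exp (ρ * t) * f t) volume s b :=
    hf.continuousOn_mul (by fun_prop)
  have hint' : IntervalIntegrable (fun t => Real.exp (ρ * t) * v t) volume s b :=
    hv.continuousOn_mul (by fun_prop)
  rw [intervalIntegral.integral_congr_ae hd, intervalIntegral.integral_add (hint.const_mul _) hint',
    intervalIntegral.integral_const_mul, hEd, intervalIntegral.integral_same] at hparts
  -- By hypothesis the primitive equals `f t - x` on `[s, b]`.
  have hG : ∫ t in s..b, ρ * Real.exp (ρ * t) * ∫ r in s..t, (-ρ * f r + v r)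
      = ∫ t in s..b, (ρ * (Real.exp (ρ * t) * f t) - ρ * Real.exp (ρ * t) * x) := by
    refine intervalIntegral.integral_congr fun t ht => ?_
    rw [uIcc_of_le hsb] at ht
    simp only [h t ht]; ring
  have hexp : ∫ t in s..b, ρ * Real.exp (ρ * t) = Real.exp (ρ * b) - Real.exp (ρ * s) := by
    rw [← hEd]
    exact intervalIntegral.integral_deriv_eq_sub (fun t _ => by fun_prop)
      (by rw [hEd]; exact Continuous.intervalIntegrable (by fun_prop) _ _)
  rw [hG, intervalIntegral.integral_sub (hint.const_mul _)
    (Continuous.intervalIntegrable (by fun_prop) _ _), intervalIntegral.integral_const_mul,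
    intervalIntegral.integral_mul_const, hexp] at hparts
  have hb := h b ⟨hsb, le_rfl⟩
  have e1 : ∀ r, Real.exp (-ρ * (b - r)) = Real.exp (-ρ * b) * Real.exp (ρ * r) := fun r => by
    rw [← Real.exp_add]; ring_nf
  have e2 : Real.exp (-ρ * b) * Real.exp (ρ * b) = 1 := by
    rw [← Real.exp_add]; simp
  simp_rw [e1, mul_assoc]
  rw [intervalIntegral.integral_const_mul]
  linear_combination (-Real.exp (-ρ * b)) * hparts + Real.exp (-ρ * b) * Real.exp (ρ * b) * hb
    - f b * e2

lemma ae_mem_Icc_prod {a b : ℝ} :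
    ∀ᵐ p ∂((volume.restrict (Icc a b)).prod P), p.1 ∈ Icc a b :=
  Measure.quasiMeasurePreserving_fst.ae (ae_restrict_mem measurableSet_Icc)

/-- Joint measurability is given only over the subtype `[a, b]`. Composing with the projection onto
`[a, b]` extends it to the line without changing the process on `[a, b]`. -/
lemma IsMeasurableAdapted.aestronglyMeasurable {a b : ℝ} {H : ℝ → Ω → ℝ}
    (hH : IsMeasurableAdapted F a b H) (hab : a ≤ b) :
    AEStronglyMeasurable (fun p : ℝ × Ω => H p.1 p.2) ((volume.restrict (Icc a b)).prod P) := by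
  have hm : Measurable (fun p : ℝ × Ω => H (projIcc a b hab p.1) p.2) :=
    hH.measurable.comp (((continuous_projIcc (h := hab)).measurable.comp measurable_fst).prodMk measurable_snd)
  refine hm.aestronglyMeasurable.congr ?_
  filter_upwards [ae_mem_Icc_prod] with p hp
  simp [projIcc_of_mem hab hp]

lemma IsControl.integrable_prod [IsFiniteMeasure P] {m : ℝ} (hT : 0 ≤ T) {u : ℝ → Ω → ℝ}
    (hu : IsControl F T m u) :
    Integrable (fun p : ℝ × Ω => u p.1 p.2) ((volume.restrict (Icc 0 T)).prod P) := by
  refine Integrable.of_bound (hu.measAdapted.aestronglyMeasurable hT) m ?_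
  filter_upwards [ae_mem_Icc_prod] with p hp
  obtain ⟨h0, h1⟩ := hu.mem p.1 hp p.2
  rw [Real.norm_eq_abs, abs_of_nonneg h0]
  exact h1

lemma IsState.integrable_prod [IsFiniteMeasure P] {ρ s x : ℝ} {σ : ℝ × ℝ → ℝ}
    {u X : ℝ → Ω → ℝ} (hs : s ≤ T) (hX : IsState P F W T ρ σ s x u X) :
    Integrable (fun p : ℝ × Ω => X p.1 p.2) ((volume.restrict (Icc s T)).prod P) := by
  have hm := hX.measAdapted.aestronglyMeasurable (P := P) hs
  have h2 : MemLp (fun p : ℝ × Ω => X p.1 p.2) 2 ((volume.restrict (Icc s T)).prod P) := by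
    refine ⟨hm, ?_⟩
    rw [eLpNorm_lt_top_iff_lintegral_rpow_enorm_lt_top (by norm_num) (by norm_num),
      lintegral_prod_symm _ (by fun_prop)]
    simpa using hX.sqIntegrable
  exact h2.integrable (by norm_num)

/-- Restriction of joint integrability to a time subinterval. -/
lemma integrable_prod_mono {a b a' b' : ℝ} {H : ℝ × Ω → ℝ} [SFinite P]
    (hH : Integrable H ((volume.restrict (Icc a b)).prod P)) (ha : a ≤ a') (hab : a' ≤ b')
    (hb : b' ≤ b) : Integrable H ((volume.restrict (uIoc a' b')).prod P) := by
  have hsub : uIoc a' b' ⊆ Icc a b := by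
    rw [uIoc_of_le hab]
    exact Ioc_subset_Icc_self.trans (Icc_subset_Icc ha hb)
  exact hH.mono_measure (Measure.prod_mono (Measure.restrict_mono hsub le_rfl) le_rfl)

lemma IsControl.intervalIntegrable_mean [IsFiniteMeasure P] {m a b : ℝ} {u : ℝ → Ω → ℝ}
    (hu : IsControl F T m u) (ha : 0 ≤ a) (hab : a ≤ b) (hb : b ≤ T) :
    IntervalIntegrable (fun t => ∫ ω, u t ω ∂P) volume a b := by
  rw [intervalIntegrable_iff]
  exact (integrable_prod_mono (P := P) (hu.integrable_prod (P := P) (ha.trans (hab.trans hb))) ha hab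
    hb).integral_prod_left

lemma IsControl.mean_mem [IsProbabilityMeasure P] {m t : ℝ} {u : ℝ → Ω → ℝ}
    (hu : IsControl F T m u) (ht : t ∈ Icc 0 T) : ∫ ω, u t ω ∂P ∈ Icc 0 m := by
  refine ⟨integral_nonneg fun ω => (hu.mem t ht ω).1, ?_⟩
  have hi : Integrable (u t) P := by
    refine Integrable.of_bound ((hu.measAdapted.adapted t ht).mono
      (F.le t) le_rfl).aestronglyMeasurable m (ae_of_all _ fun ω => ?_)
    rw [Real.norm_eq_abs, abs_of_nonneg (hu.mem t ht ω).1]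
    exact (hu.mem t ht ω).2
  simpa using integral_mono hi (integrable_const m) fun ω => (hu.mem t ht ω).2

/-- Expectation of the state equation: the Itô term drops out, and with it `σ`. Fubini exchanges
mean and time integral in the drift. -/
lemma IsState.integrable_and_mean_eq [IsProbabilityMeasure P] (hW : IsBrownianOn P F T W)
    {ρ s x m : ℝ} {σ : ℝ × ℝ → ℝ} {u X : ℝ → Ω → ℝ} (h0 : 0 ≤ s) (hu : IsControl F T m u)
    (hX : IsState P F W T ρ σ s x u X) {t : ℝ} (ht : t ∈ Icc s T) :
    Integrable (X t) P ∧
    ∫ ω, X t ω ∂P = x + ∫ r in s..t, (-ρ * ∫ ω, X r ω ∂P + ∫ ω, u r ω ∂P) := by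
  obtain ⟨Z, hZ, heq⟩ := hX.equation t ht
  have hXi := integrable_prod_mono (P := P) (hX.integrable_prod (P := P) (ht.1.trans ht.2)) le_rfl ht.1 ht.2
  have hui := integrable_prod_mono (P := P) (hu.integrable_prod (P := P) (h0.trans (ht.1.trans ht.2))) h0 ht.1 ht.2
  have hk : Integrable (Function.uncurry fun r ω => -ρ * X r ω + u r ω)
      ((volume.restrict (uIoc s t)).prod P) := (hXi.const_mul (-ρ)).add hui
  have hD : Integrable (fun ω => ∫ r in s..t, (-ρ * X r ω + u r ω)) P := by
    have := hk.integral_prod_right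
    rw [uIoc_of_le ht.1] at this
    simp_rw [intervalIntegral.integral_of_le ht.1]
    exact this
  have hZi := hZ.1.integrable (q := 2) (by norm_num)
  have hxD : Integrable (fun ω => x + ∫ r in s..t, (-ρ * X r ω + u r ω)) P :=
    (integrable_const x).add hD
  refine ⟨(hxD.add hZi).congr (heq.mono fun ω h => h.symm), ?_⟩
  rw [integral_congr_ae heq, integral_add hxD hZi, integral_add (integrable_const x) hD,
    hZ.integral_eq_zero hW h0 ht.2, ← intervalIntegral_integral_swap hk]
  simp only [integral_const, probReal_univ, one_smul, add_zero, add_right_inj]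
  -- Fubini yields integrability of `X r` and `u r` only for almost every `r`, which suffices under
  -- the time integral.
  refine intervalIntegral.integral_congr_ae ?_
  have h1 := (ae_restrict_iff' measurableSet_uIoc).1 hXi.prod_right_ae
  have h2 := (ae_restrict_iff' measurableSet_uIoc).1 hui.prod_right_ae
  filter_upwards [h1, h2] with r hr1 hr2 hr
  rw [integral_add ((hr1 hr).const_mul _) (hr2 hr), integral_const_mul]

lemma IsState.integral_terminal [IsProbabilityMeasure P] (hW : IsBrownianOn P F T W)
    {ρ s x m : ℝ} {σ : ℝ × ℝ → ℝ} {u X : ℝ → Ω → ℝ} (h0 : 0 ≤ s) (hsT : s ≤ T)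
    (hu : IsControl F T m u) (hX : IsState P F W T ρ σ s x u X) :
    ∫ ω, X T ω ∂P = Real.exp (-ρ * (T - s)) * x
      + ∫ r in s..T, Real.exp (-ρ * (T - r)) * ∫ ω, u r ω ∂P := by
  refine eq_exp_mul_add_integral hsT ?_ (hu.intervalIntegrable_mean h0 hsT le_rfl)
    (f := fun t => ∫ ω, X t ω ∂P) fun t ht => (hX.integrable_and_mean_eq hW h0 hu ht).2
  rw [intervalIntegrable_iff]
  exact (integrable_prod_mono (P := P) (hX.integrable_prod hsT) le_rfl hsT le_rfl).integral_prod_left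

lemma IsControl.integrable_cost [IsProbabilityMeasure P] {a m c : ℝ} {u : ℝ → Ω → ℝ}
    (ha : 0 ≤ a) (haT : a ≤ T) (hu : IsControl F T m u) :
    Integrable (fun ω => ∫ t in a..T, Real.exp (-c * t) * u t ω) P ∧
    ∫ ω, (∫ t in a..T, Real.exp (-c * t) * u t ω) ∂P
      = ∫ t in a..T, Real.exp (-c * t) * ∫ ω, u t ω ∂P := by
  have hui := integrable_prod_mono (P := P) (hu.integrable_prod (P := P) (ha.trans haT)) ha haT le_rfl
  have hk : Integrable (Function.uncurry fun t ω => Real.exp (-c * t) * u t ω)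
      ((volume.restrict (uIoc a T)).prod P) := by
    refine hui.bdd_mul (c := Real.exp (|c| * T)) (f := fun p : ℝ × Ω => Real.exp (-c * p.1))
      (by fun_prop) ?_
    have : ∀ᵐ p ∂((volume.restrict (uIoc a T)).prod P), p.1 ∈ uIoc a T :=
      Measure.quasiMeasurePreserving_fst.ae (ae_restrict_mem measurableSet_uIoc)
    filter_upwards [this] with p hp
    rw [uIoc_of_le haT] at hp
    rw [Real.norm_eq_abs, Real.abs_exp]
    refine Real.exp_le_exp.2 ((mul_le_mul_of_nonneg_right (neg_le_abs c)
      (ha.trans hp.1.le)).trans (mul_le_mul_of_nonneg_left hp.2 (abs_nonneg c)))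
  constructor
  · have := hk.integral_prod_right
    rw [uIoc_of_le haT] at this
    simp_rw [intervalIntegral.integral_of_le haT]
    exact this
  · rw [← intervalIntegral_integral_swap hk]
    simp_rw [integral_const_mul]

lemma IsState.integrable_reward [IsProbabilityMeasure P] (hW : IsBrownianOn P F T W)
    {ρ s x m a c γ : ℝ} {σ : ℝ × ℝ → ℝ} {u X : ℝ → Ω → ℝ} (h0 : 0 ≤ s) (hsT : s ≤ T)
    (ha : 0 ≤ a) (haT : a ≤ T) (hu : IsControl F T m u) (hX : IsState P F W T ρ σ s x u X) :
    Integrable (reward T c γ a u X) P :=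
  ((hX.integrable_and_mean_eq hW h0 hu ⟨hsT, le_rfl⟩).1.const_mul γ).sub
    (hu.integrable_cost ha haT).1

/-- The net marginal value `γ e^{-ρ(T-t)} - e^{-ct}` of the control at time `t`. -/
def netGain (T ρ c γ t : ℝ) : ℝ := γ * Real.exp (-ρ * (T - t)) - Real.exp (-c * t)

lemma continuous_netGain {T ρ c γ : ℝ} : Continuous (netGain T ρ c γ) := by
  unfold netGain; fun_prop

/-- Everything random has been averaged out: the control enters only through its mean. The last
integral is the cost paid before the state starts moving. -/
lemma IsState.performance_eq [IsProbabilityMeasure P] (hW : IsBrownianOn P F T W)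
    {ρ s x m a c γ : ℝ} {σ : ℝ × ℝ → ℝ} {u X : ℝ → Ω → ℝ} (hsT : s ≤ T)
    (ha : 0 ≤ a) (has : a ≤ s) (hu : IsControl F T m u) (hX : IsState P F W T ρ σ s x u X) :
    performance P T c γ a u X = slope T ρ γ s * x
      + (∫ t in s..T, netGain T ρ c γ t * ∫ ω, u t ω ∂P)
      - ∫ t in a..s, Real.exp (-c * t) * ∫ ω, u t ω ∂P := by
  have h0 := ha.trans has
  have hv := fun b d (hb : 0 ≤ b) (hbd : b ≤ d) (hd : d ≤ T) =>
    hu.intervalIntegrable_mean (P := P) hb hbd hd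
  have hcost := fun b d (hb : 0 ≤ b) (hbd : b ≤ d) (hd : d ≤ T) =>
    (hv b d hb hbd hd).continuousOn_mul (g := fun t => Real.exp (-c * t)) (by fun_prop)
  have hgain := (hv s T h0 hsT le_rfl).continuousOn_mul
    (g := fun t => γ * Real.exp (-ρ * (T - t))) (by fun_prop)
  unfold performance reward
  rw [integral_sub ((hX.integrable_and_mean_eq hW h0 hu ⟨hsT, le_rfl⟩).1.const_mul γ)
    (hu.integrable_cost ha (has.trans hsT)).1, (hu.integrable_cost ha (has.trans hsT)).2,
    integral_const_mul, hX.integral_terminal hW h0 hsT hu,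
    ← intervalIntegral.integral_add_adjacent_intervals (hcost a s ha has hsT)
      (hcost s T h0 hsT le_rfl)]
  simp_rw [netGain, sub_mul]
  rw [intervalIntegral.integral_sub hgain (hcost s T h0 hsT le_rfl)]
  simp_rw [mul_assoc]
  rw [intervalIntegral.integral_const_mul, slope]
  ring

end

/-! ### Deterministic optimization and the bang-bang policy -/

section

variable {Ω : Type*} [mΩ : MeasurableSpace Ω]

/-- After taking logarithms, `γ e^{-ρ(T-t)} ≥ e^{-ct}` reads `(ρ + c) t ≥ ρ T - log γ`. -/
lemma netGain_nonneg {T ρ c γ t : ℝ} (hρc : 0 < ρ + c) (hγ : 0 < γ)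
    (ht : switchTime T ρ c γ < t) : 0 ≤ netGain T ρ c γ t := by
  rw [switchTime, div_lt_iff₀ hρc] at ht
  rw [netGain, sub_nonneg, ← Real.exp_log hγ, ← Real.exp_add, Real.exp_le_exp]
  linarith

lemma netGain_nonpos {T ρ c γ t : ℝ} (hρc : 0 < ρ + c) (hγ : 0 < γ)
    (ht : t ≤ switchTime T ρ c γ) : netGain T ρ c γ t ≤ 0 := by
  rw [switchTime, le_div_iff₀ hρc] at ht
  rw [netGain, sub_nonpos, ← Real.exp_log hγ, ← Real.exp_add, Real.exp_le_exp]
  linarith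

/-- The bang-bang policy maximizes the net gain at every time. -/
lemma netGain_mul_le {T ρ c γ m t v : ℝ} (hρc : 0 < ρ + c) (hγ : 0 < γ) (hv : v ∈ Icc 0 m) :
    netGain T ρ c γ t * v ≤ netGain T ρ c γ t * bangBang T ρ c γ m t := by
  unfold bangBang
  split_ifs with h
  · simpa using mul_nonpos_of_nonpos_of_nonneg (netGain_nonpos hρc hγ h) hv.1
  · exact mul_le_mul_of_nonneg_left hv.2 (netGain_nonneg hρc hγ (not_le.1 h))

lemma integral_netGain {T ρ c γ m a : ℝ} (hρ : ρ ≠ 0) (hc : c ≠ 0) :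
    ∫ t in a..T, netGain T ρ c γ t * m = b₁ T ρ c γ m a := by
  have hderiv : ∀ t, HasDerivAt
      (fun t => m * (γ / ρ * Real.exp (-ρ * (T - t)) + Real.exp (-c * t) / c))
      (netGain T ρ c γ t * m) t := by
    intro t
    have h1 : HasDerivAt (fun t => Real.exp (-ρ * (T - t)))
        (Real.exp (-ρ * (T - t)) * (-ρ * (0 - 1))) t :=
      (((hasDerivAt_const t T).sub (hasDerivAt_id t)).const_mul (-ρ)).exp
    have h2 : HasDerivAt (fun t => Real.exp (-c * t)) (Real.exp (-c * t) * (-c * 1)) t :=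
      ((hasDerivAt_id t).const_mul (-c)).exp
    refine (((h1.const_mul (γ / ρ)).add (h2.div_const c)).const_mul m).congr_deriv ?_
    unfold netGain
    field_simp
    ring
  rw [intervalIntegral.integral_eq_sub_of_hasDerivAt (fun t _ => hderiv t)
    ((continuous_netGain.mul continuous_const).intervalIntegrable _ _)]
  simp only [b₁, sub_self, mul_zero, Real.exp_zero]
  ring

lemma intervalIntegrable_netGain_mul_ite {T ρ c γ m τ a b : ℝ} :
    IntervalIntegrable (fun t => netGain T ρ c γ t * if t ≤ τ then 0 else m) volume a b := by
  refine IntervalIntegrable.continuousOn_mul ?_ continuous_netGain.continuousOn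
  rw [intervalIntegrable_iff]
  have : IsFiniteMeasure (volume.restrict (uIoc a b)) := ⟨by simp [uIoc]⟩
  refine Integrable.of_bound
    (Measurable.ite measurableSet_Iic measurable_const measurable_const).aestronglyMeasurable
    |m| (ae_of_all _ fun t => ?_)
  split_ifs <;> simp

/-- Here `q` stands for the switching time clamped to `[s, T]`, so one computation serves a switch
before `s`, inside the interval or after `T`. -/
lemma integral_netGain_mul_ite {T ρ c γ m τ s q : ℝ} (hρ : ρ ≠ 0) (hc : c ≠ 0) (hsq : s ≤ q)
    (hqT : q ≤ T) (h1 : ∀ t ∈ Ioc s q, t ≤ τ) (h2 : ∀ t ∈ Ioc q T, τ < t) :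
    ∫ t in s..T, netGain T ρ c γ t * (if t ≤ τ then 0 else m) = b₁ T ρ c γ m q := by
  rw [← intervalIntegral.integral_add_adjacent_intervals
    (intervalIntegrable_netGain_mul_ite (a := s) (b := q)) intervalIntegrable_netGain_mul_ite,
    ← integral_netGain hρ hc]
  have e1 : ∫ t in s..q, netGain T ρ c γ t * (if t ≤ τ then 0 else m) = 0 := by
    refine (intervalIntegral.integral_congr_ae (ae_of_all _ fun t ht => ?_)).trans
      intervalIntegral.integral_zero
    rw [uIoc_of_le hsq] at ht
    simp [h1 t ht]
  rw [e1, zero_add]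
  refine intervalIntegral.integral_congr_ae (ae_of_all _ fun t ht => ?_)
  rw [uIoc_of_le hqT] at ht
  simp [(h2 t ht)]

lemma integral_netGain_mul_bangBang {T ρ c γ m s : ℝ} (hρ : ρ ≠ 0) (hc : c ≠ 0) (hsT : s ≤ T) :
    ∫ t in s..T, netGain T ρ c γ t * bangBang T ρ c γ m t = intercept T ρ c γ m s := by
  unfold bangBang intercept
  split_ifs with h
  · exact integral_netGain_mul_ite hρ hc (le_min h hsT) (min_le_right _ _)
      (fun t ht => ht.2.trans (min_le_left _ _))
      fun t ht => (min_lt_iff.1 ht.1).resolve_right (not_lt.2 ht.2)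
  · exact integral_netGain_mul_ite hρ hc le_rfl hsT (fun t ht => absurd ht.1 (not_lt.2 ht.2))
      fun t ht => (not_le.1 h).trans ht.1

variable {P : Measure Ω} {F : Filtration ℝ mΩ} {T : ℝ} {W : ℝ → Ω → ℝ}

lemma isControl_ite {m τ : ℝ} (hm : 0 ≤ m) :
    IsControl F T m (fun t _ => if t ≤ τ then 0 else m) where
  measAdapted :=
    { measurable := Measurable.ite (measurableSet_le (by fun_prop) measurable_const)
        measurable_const measurable_const
      adapted := fun _ _ => measurable_const }
  mem := fun t _ _ => by
    split_ifs
    exacts [⟨le_rfl, hm⟩, ⟨hm, le_rfl⟩]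

/-- The mean control is a competitor in the pointwise maximization, and the cost on `[a, s]` is
nonnegative. -/
lemma IsState.performance_le [IsProbabilityMeasure P] (hW : IsBrownianOn P F T W)
    {ρ s x m a c γ : ℝ} {σ : ℝ × ℝ → ℝ} {u X : ℝ → Ω → ℝ} (hρ : 0 < ρ) (hc : 0 < c)
    (hγ : 0 < γ) (hsT : s ≤ T) (ha : 0 ≤ a) (has : a ≤ s)
    (hu : IsControl F T m u) (hX : IsState P F W T ρ σ s x u X) :
    performance P T c γ a u X ≤ slope T ρ γ s * x + intercept T ρ c γ m s := by
  rw [hX.performance_eq hW hsT ha has hu, ← integral_netGain_mul_bangBang hρ.ne' hc.ne' hsT]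
  have h1 : 0 ≤ ∫ t in a..s, Real.exp (-c * t) * ∫ ω, u t ω ∂P :=
    intervalIntegral.integral_nonneg has fun t ht => mul_nonneg (Real.exp_pos _).le
      (hu.mean_mem ⟨ha.trans ht.1, ht.2.trans hsT⟩).1
  have h2 : ∫ t in s..T, netGain T ρ c γ t * ∫ ω, u t ω ∂P
      ≤ ∫ t in s..T, netGain T ρ c γ t * bangBang T ρ c γ m t :=
    intervalIntegral.integral_mono_on hsT
      ((hu.intervalIntegrable_mean (ha.trans has) hsT le_rfl).continuousOn_mul
        continuous_netGain.continuousOn) intervalIntegrable_netGain_mul_ite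
      fun t ht => netGain_mul_le (add_pos hρ hc) hγ
        (hu.mean_mem ⟨(ha.trans has).trans ht.1, ht.2⟩)
  linarith

/-- Waiting until `s` and then following the bang-bang policy attains the value. -/
lemma IsState.performance_bangBang [IsProbabilityMeasure P] (hW : IsBrownianOn P F T W)
    {ρ s x m a c γ τ : ℝ} {σ : ℝ × ℝ → ℝ} {X : ℝ → Ω → ℝ} (hρ : 0 < ρ) (hc : 0 < c)
    (hsT : s ≤ T) (ha : 0 ≤ a) (has : a ≤ s) (hm : 0 ≤ m)
    (hτ : ∀ t, s < t → (t ≤ τ ↔ t ≤ switchTime T ρ c γ)) (hτs : ∀ t ∈ Ioc a s, t ≤ τ)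
    (hX : IsState P F W T ρ σ s x (fun t _ => if t ≤ τ then 0 else m) X) :
    performance P T c γ a (fun t _ => if t ≤ τ then 0 else m) X
      = slope T ρ γ s * x + intercept T ρ c γ m s := by
  rw [hX.performance_eq hW hsT ha has (isControl_ite hm),
    ← integral_netGain_mul_bangBang hρ.ne' hc.ne' hsT]
  simp only [integral_const, probReal_univ, one_smul]
  have h1 : ∫ t in a..s, Real.exp (-c * t) * (if t ≤ τ then 0 else m) = 0 := by
    refine (intervalIntegral.integral_congr_ae (ae_of_all _ fun t ht => ?_)).trans
      intervalIntegral.integral_zero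
    rw [uIoc_of_le has] at ht
    simp [hτs t ht]
  rw [h1, sub_zero, add_right_inj]
  refine intervalIntegral.integral_congr_ae (ae_of_all _ fun t ht => ?_)
  rw [uIoc_of_le hsT] at ht
  simp [bangBang, hτ t ht.1]

end

/-! ### Sums along time grids: Gronwall, isometry, maximal inequality -/

section

variable {Ω : Type*} [mΩ : MeasurableSpace Ω]

section GridSum

variable {Ω : Type*}

/-- The sum `∑_{i < j} α_i (τ_{i+1} - τ_i) + β_i (W_{τ_{i+1}} - W_{τ_i})` along a time grid. -/
def gridSum (W : ℝ → Ω → ℝ) (τ : ℕ → ℝ) (α β : ℕ → Ω → ℝ) (j : ℕ) (ω : Ω) : ℝ :=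
  ∑ i ∈ Finset.range j,
    (α i ω * (τ (i + 1) - τ i) + β i ω * (W (τ (i + 1)) ω - W (τ i) ω))

variable {W : ℝ → Ω → ℝ} {τ τ' : ℕ → ℝ} {α α' β β' : ℕ → Ω → ℝ} {j : ℕ} {ω : Ω}

@[simp] lemma gridSum_zero : gridSum W τ α β 0 ω = 0 := by simp [gridSum]

lemma gridSum_succ : gridSum W τ α β (j + 1) ω = gridSum W τ α β j ω
    + (α j ω * (τ (j + 1) - τ j) + β j ω * (W (τ (j + 1)) ω - W (τ j) ω)) := by
  simp [gridSum, Finset.sum_range_succ]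

lemma gridSum_sub : gridSum W τ (α - α') (β - β') j ω
    = gridSum W τ α β j ω - gridSum W τ α' β' j ω := by
  rw [gridSum, gridSum, gridSum, ← Finset.sum_sub_distrib]
  refine Finset.sum_congr rfl fun i _ => ?_
  simp only [Pi.sub_apply]
  ring

lemma gridSum_split : gridSum W τ α β j ω
    = gridSum W τ α 0 j ω + gridSum W τ 0 β j ω := by
  rw [gridSum, gridSum, gridSum, ← Finset.sum_add_distrib]
  simp

/-- When each cell is cut into `r` pieces that keep its coefficient `i / r`, the increments
telescope within the cell. This puts schemes on different grids onto a common grid. -/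
lemma gridSum_refine {r : ℕ} (hr : 0 < r) (h : ∀ i, τ' (r * i) = τ i) :
    gridSum W τ' (fun i => α (i / r)) (fun i => β (i / r)) (r * j) ω = gridSum W τ α β j ω := by
  induction j with
  | zero => simp
  | succ j ih =>
    have hdiv : ∀ l ∈ Finset.range r, (r * j + l) / r = j := fun l hl => by
      rw [Nat.mul_add_div hr, Nat.div_eq_of_lt (Finset.mem_range.1 hl), add_zero]
    rw [gridSum_succ, ← ih, mul_add, mul_one, gridSum, Finset.sum_range_add, ← gridSum,
      add_right_inj]
    have h1 := Finset.sum_range_sub (fun l => τ' (r * j + l)) r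
    have h2 := Finset.sum_range_sub (fun l => W (τ' (r * j + l)) ω) r
    simp only [add_zero, ← mul_add_one, h] at h1 h2
    rw [← h1, ← h2, Finset.mul_sum, Finset.mul_sum, ← Finset.sum_add_distrib]
    refine Finset.sum_congr rfl fun l hl => ?_
    rw [hdiv l hl]
    rfl

lemma gridSum_congr (hτ : ∀ i ≤ j, τ i = τ' i) :
    gridSum W τ α β j ω = gridSum W τ' α β j ω := by
  refine Finset.sum_congr rfl fun i hi => ?_
  rw [hτ i (Finset.mem_range.1 hi).le, hτ (i + 1) (Finset.mem_range.1 hi)]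

/-- Stopping the grid at its `j`-th point truncates the sum. -/
lemma gridSum_min (hτ : Monotone τ) {N : ℕ} (hj : j ≤ N) :
    gridSum W (fun i => min (τ i) (τ j)) α β N ω = gridSum W τ α β j ω := by
  obtain ⟨k, rfl⟩ := Nat.exists_eq_add_of_le hj
  rw [gridSum, Finset.sum_range_add, Finset.sum_eq_zero (s := Finset.range k), add_zero]
  · exact gridSum_congr (j := j) fun i hi => min_eq_left (hτ hi)
  · intro i _
    rw [min_eq_right (hτ (by lia : j ≤ j + i)), min_eq_right (hτ (by lia : j ≤ j + i + 1))]
    ring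

lemma continuousOn_gridSum_min {T s : ℝ} (hs : 0 ≤ s) (hτ : ∀ i, τ i ∈ Icc 0 T)
    (hW : ContinuousOn (fun t => W t ω) (Icc 0 T)) :
    ContinuousOn (fun t => gridSum W (fun i => min (τ i) t) α β j ω) (Icc s T) := by
  have hmin : ∀ i, ContinuousOn (fun t => min (τ i) t) (Icc s T) := fun i => by fun_prop
  have hWmin : ∀ i, ContinuousOn (fun t => W (min (τ i) t) ω) (Icc s T) := fun i =>
    hW.comp (hmin i) fun t ht => ⟨le_min (hτ i).1 (hs.trans ht.1), min_le_of_right_le ht.2⟩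
  refine continuousOn_finsetSum _ fun i _ => ?_
  exact (continuousOn_const.mul ((hmin _).sub (hmin _))).add
    (continuousOn_const.mul ((hWmin _).sub (hWmin _)))

/-- The right side does not depend on `j`: it dominates the running maximum of the drift part. -/
lemma abs_gridSum_drift_le (hτ : Monotone τ) {N : ℕ} (hj : j ≤ N) :
    |gridSum W τ α 0 j ω| ≤ gridSum W τ (fun i ω => |α i ω|) 0 N ω := by
  have h0 : ∀ i, 0 ≤ τ (i + 1) - τ i := fun i => sub_nonneg.2 (hτ i.le_succ)
  unfold gridSum
  simp only [Pi.zero_apply, zero_mul, add_zero]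
  refine (Finset.abs_sum_le_sum_abs _ _).trans ?_
  simp_rw [abs_mul, abs_of_nonneg (h0 _)]
  exact Finset.sum_le_sum_of_subset_of_nonneg (Finset.range_subset_range.2 hj) fun i _ _ =>
    mul_nonneg (abs_nonneg _) (h0 i)

end GridSum

/-- A discrete Gronwall inequality along a time grid. -/
lemma discrete_gronwall {τ : ℕ → ℝ} (hτ : Monotone τ) {E : ℕ → ℝ} {B C : ℝ} (hB : 0 ≤ B)
    (hC : 0 ≤ C) (hE : 0 ≤ E 0)
    (h : ∀ j, E (j + 1) ≤ (1 + C * (τ (j + 1) - τ j)) * E j + B * (τ (j + 1) - τ j)) (j : ℕ) :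
    E j ≤ (E 0 + B * (τ j - τ 0)) * Real.exp (C * (τ j - τ 0)) := by
  induction j with
  | zero => simp
  | succ j ih =>
    set Δ := τ (j + 1) - τ j with hΔ
    set d := τ j - τ 0 with hd
    have hΔ0 : 0 ≤ Δ := sub_nonneg.2 (hτ j.le_succ)
    have hd0 : 0 ≤ d := sub_nonneg.2 (hτ j.zero_le)
    have e : τ (j + 1) - τ 0 = d + Δ := by rw [hΔ, hd]; ring
    have h1 : 1 + C * Δ ≤ Real.exp (C * Δ) := by linarith [Real.add_one_le_exp (C * Δ)]
    have h2 : (1 + C * Δ) * E j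
        ≤ Real.exp (C * Δ) * ((E 0 + B * d) * Real.exp (C * d)) :=
      (mul_le_mul_of_nonneg_left ih (by positivity)).trans
        (mul_le_mul_of_nonneg_right h1 (by positivity))
    have h3 : B * Δ * 1 ≤ B * Δ * Real.exp (C * (d + Δ)) :=
      mul_le_mul_of_nonneg_left (Real.one_le_exp (by positivity)) (by positivity)
    rw [e]
    calc E (j + 1) ≤ _ := h j
      _ ≤ Real.exp (C * Δ) * ((E 0 + B * d) * Real.exp (C * d))
          + B * Δ * Real.exp (C * (d + Δ)) := by linarith
      _ = (E 0 + B * (d + Δ)) * Real.exp (C * (d + Δ)) := by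
        rw [mul_add C, Real.exp_add]; ring

variable {P : Measure Ω} {F : Filtration ℝ mΩ} {T : ℝ} {W : ℝ → Ω → ℝ}

/-- `β i` is square integrable and known at the time `τ i`. -/
structure GridAdapted (P : Measure Ω) (F : Filtration ℝ mΩ) (τ : ℕ → ℝ) (β : ℕ → Ω → ℝ) :
    Prop where
  meas : ∀ i, Measurable[F (τ i)] (β i)
  memLp : ∀ i, MemLp (β i) 2 P

lemma GridAdapted.sub {τ : ℕ → ℝ} {α β : ℕ → Ω → ℝ} (hα : GridAdapted P F τ α)
    (hβ : GridAdapted P F τ β) : GridAdapted P F τ (α - β) :=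
  ⟨fun i => (hα.meas i).sub (hβ.meas i), fun i => (hα.memLp i).sub (hβ.memLp i)⟩

lemma GridAdapted.zero {τ : ℕ → ℝ} : GridAdapted P F τ (0 : ℕ → Ω → ℝ) :=
  ⟨fun _ => measurable_const, fun _ => MemLp.zero⟩

/-- The coefficient of a fine cell was fixed at the start of the coarse cell containing it, hence no
later than the fine grid point. -/
lemma GridAdapted.refine {τ τ' : ℕ → ℝ} {β : ℕ → Ω → ℝ} (hβ : GridAdapted P F τ β) {r : ℕ}
    (h : ∀ i, τ' (r * i) = τ i) (hτ' : Monotone τ') :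
    GridAdapted P F τ' (fun i => β (i / r)) := by
  refine ⟨fun i => (hβ.meas (i / r)).mono (F.mono ?_) le_rfl, fun i => hβ.memLp _⟩
  rw [← h]
  exact hτ' (Nat.mul_div_le i r)

lemma GridAdapted.gridSum (hW : IsBrownianOn P F T W) {τ : ℕ → ℝ} (hτ : Monotone τ)
    (hτT : ∀ i, τ i ∈ Icc 0 T) {α β : ℕ → Ω → ℝ} (hα : GridAdapted P F τ α)
    (hβ : GridAdapted P F τ β) : GridAdapted P F τ (gridSum W τ α β) := by
  have key : ∀ j, Measurable[F (τ j)] (Goodwill.gridSum W τ α β j) ∧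
      MemLp (Goodwill.gridSum W τ α β j) 2 P := by
    intro j
    induction j with
    | zero =>
      have : Goodwill.gridSum W τ α β 0 = fun _ => 0 := by ext; simp
      rw [this]
      exact ⟨measurable_const, MemLp.zero⟩
    | succ j ih =>
      have : Goodwill.gridSum W τ α β (j + 1) = fun ω => Goodwill.gridSum W τ α β j ω
          + (α j ω * (τ (j + 1) - τ j) + β j ω * (W (τ (j + 1)) ω - W (τ j) ω)) := by
        ext; exact gridSum_succ
      rw [this]
      have hle := F.mono (hτ j.le_succ)
      have hd := hW.measurable_increment (hτT j).1 (hτ j.le_succ) (hτT (j + 1)).2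
      refine ⟨(ih.1.mono hle le_rfl).add ((((hα.meas j).mono hle le_rfl).mul_const _).add
        (((hβ.meas j).mono hle le_rfl).mul hd)), ih.2.add ?_⟩
      exact ((hα.memLp j).mul_const _).add (hW.memLp_mul_increment (hτT j).1 (hτ j.le_succ)
        (hτT (j + 1)).2 (hβ.meas j) (hβ.memLp j))
  exact ⟨fun j => (key j).1, fun j => (key j).2⟩

/-- The noise adds exactly `Δ E β²`. The old value is multiplied only by `1 + Δ`, which is the form
the discrete Gronwall inequality can iterate. -/
lemma IsBrownianOn.integral_step_sq_le (hW : IsBrownianOn P F T W) {s t : ℝ} (hs : 0 ≤ s)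
    (hst : s ≤ t) (ht : t ≤ T) {A α β : Ω → ℝ} (hA : Measurable[F s] A) (hA2 : MemLp A 2 P)
    (hα : Measurable[F s] α) (hα2 : MemLp α 2 P) (hβ : Measurable[F s] β) (hβ2 : MemLp β 2 P) :
    ∫ ω, (A ω + (α ω * (t - s) + β ω * (W t ω - W s ω))) ^ 2 ∂P
      ≤ (1 + (t - s)) * ∫ ω, A ω ^ 2 ∂P
        + (t - s) * ((1 + (t - s)) * ∫ ω, α ω ^ 2 ∂P + ∫ ω, β ω ^ 2 ∂P) := by
  have hΔ : 0 ≤ t - s := sub_nonneg.2 hst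
  have hAα : MemLp (fun ω => A ω + α ω * (t - s)) 2 P := hA2.add (hα2.mul_const _)
  have h1 := hW.integral_add_mul_increment_sq hs hst ht (A := fun ω => A ω + α ω * (t - s))
    (hA.add (hα.mul_const (t - s))) hAα hβ hβ2
  have hi1 : Integrable (fun ω => (1 + (t - s)) * A ω ^ 2) P := hA2.integrable_sq.const_mul _
  have hi2 : Integrable (fun ω => (t - s) * (1 + (t - s)) * α ω ^ 2) P :=
    hα2.integrable_sq.const_mul _
  have h2 : ∫ ω, (A ω + α ω * (t - s)) ^ 2 ∂P
      ≤ (1 + (t - s)) * ∫ ω, A ω ^ 2 ∂P + (t - s) * (1 + (t - s)) * ∫ ω, α ω ^ 2 ∂P := by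
    rw [← integral_const_mul, ← integral_const_mul, ← integral_add hi1 hi2]
    refine integral_mono hAα.integrable_sq (hi1.add hi2) fun ω => ?_
    -- The right side minus the left side is exactly `Δ (A - α)²`.
    have := mul_nonneg hΔ (sq_nonneg (A ω - α ω))
    nlinarith
  simp_rw [← add_assoc]
  rw [h1]
  linarith

/-- The Itô isometry along a time grid. -/
lemma integral_gridSum_sq (hW : IsBrownianOn P F T W) {τ : ℕ → ℝ} (hτ : Monotone τ)
    (hτT : ∀ i, τ i ∈ Icc 0 T) {β : ℕ → Ω → ℝ} (hβ : GridAdapted P F τ β) (j : ℕ) :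
    ∫ ω, gridSum W τ 0 β j ω ^ 2 ∂P
      = ∑ i ∈ Finset.range j, (τ (i + 1) - τ i) * ∫ ω, β i ω ^ 2 ∂P := by
  induction j with
  | zero => simp
  | succ j ih =>
    have hS := GridAdapted.gridSum hW hτ hτT GridAdapted.zero hβ
    have := hW.integral_add_mul_increment_sq (hτT j).1 (hτ j.le_succ) (hτT (j + 1)).2
      (hS.meas j) (hS.memLp j) (hβ.meas j) (hβ.memLp j)
    simp_rw [gridSum_succ, Pi.zero_apply, zero_mul, zero_add]
    rw [this, ih, Finset.sum_range_succ]

lemma sum_grid_mul_le {τ : ℕ → ℝ} (hτ : Monotone τ) {f : ℕ → ℝ} {B : ℝ} (hf : ∀ i, f i ≤ B)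
    (j : ℕ) : ∑ i ∈ Finset.range j, (τ (i + 1) - τ i) * f i ≤ (τ j - τ 0) * B := by
  rw [← Finset.sum_range_sub, Finset.sum_mul]
  exact Finset.sum_le_sum fun i _ =>
    mul_le_mul_of_nonneg_left (hf i) (sub_nonneg.2 (hτ i.le_succ))

/-- This is nonnegativity of the variance of `|f|`. -/
lemma integral_abs_le_sqrt [IsProbabilityMeasure P] {f : Ω → ℝ} (hf : MemLp f 2 P) :
    ∫ ω, |f ω| ∂P ≤ √(∫ ω, f ω ^ 2 ∂P) := by
  refine Real.le_sqrt_of_sq_le ?_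
  have h := variance_eq_sub hf.abs
  have h0 := variance_nonneg (fun ω => |f ω|) P
  have e : (fun ω => |f ω|) = |f| := rfl
  rw [e, h] at h0
  simpa using h0

/-- The grid sums of the Brownian increments form a martingale. -/
lemma martingale_gridSum [IsFiniteMeasure P] (hW : IsBrownianOn P F T W) {τ : ℕ → ℝ}
    (hτ : Monotone τ) (hτT : ∀ i, τ i ∈ Icc 0 T) {β : ℕ → Ω → ℝ} (hβ : GridAdapted P F τ β) :
    Martingale (gridSum W τ 0 β) (⟨fun i => F (τ i), fun _ _ h => F.mono (hτ h), fun _ => F.le _⟩ :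
      Filtration ℕ mΩ) P := by
  have hS := GridAdapted.gridSum hW hτ hτT GridAdapted.zero hβ
  refine martingale_of_setIntegral_eq_succ (fun i => (hS.meas i).stronglyMeasurable)
    (fun i => (hS.memLp i).integrable (by norm_num)) fun i A hA => ?_
  have hA' : MeasurableSet A := F.le _ _ hA
  simp_rw [gridSum_succ, Pi.zero_apply, zero_mul, zero_add]
  have hBW := (hW.memLp_mul_increment (hτT i).1 (hτ i.le_succ) (hτT (i + 1)).2
    (hβ.meas i) (hβ.memLp i)).integrable (q := 2) (by norm_num)
  rw [integral_add ((hS.memLp i).integrable (by norm_num)).integrableOn hBW.integrableOn,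
    ← integral_indicator hA' (f := fun ω => β i ω * _)]
  -- The event `A` is known at `τ i`, so its indicator can be absorbed into the coefficient.
  have h0 := hW.integral_mul_increment (hτT i).1 (hτ i.le_succ) (hτT (i + 1)).2
    ((hβ.meas i).indicator hA)
  have e : (A.indicator fun ω => β i ω * (W (τ (i + 1)) ω - W (τ i) ω))
      = fun ω => A.indicator (β i) ω * (W (τ (i + 1)) ω - W (τ i) ω) := by
    ext ω; by_cases hω : ω ∈ A <;> simp [hω]
  rw [e, h0, add_zero]

/-- Doob's maximal inequality along a time grid. -/
lemma measure_exists_le_abs_gridSum_le [IsProbabilityMeasure P] (hW : IsBrownianOn P F T W)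
    {τ : ℕ → ℝ} (hτ : Monotone τ) (hτT : ∀ i, τ i ∈ Icc 0 T) {β : ℕ → Ω → ℝ}
    (hβ : GridAdapted P F τ β) {B ε : ℝ} (hB : ∀ i, ∫ ω, β i ω ^ 2 ∂P ≤ B) (hε : 0 < ε) (J : ℕ) :
    P {ω | ∃ j ≤ J, ε ≤ |gridSum W τ 0 β j ω|}
      ≤ ENNReal.ofReal (√((τ J - τ 0) * B) / ε) := by
  have hS := GridAdapted.gridSum hW hτ hτT GridAdapted.zero hβ
  have hmart := martingale_gridSum hW hτ hτT hβ
  lift ε to NNReal using hε.le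
  -- `|S|` is the supremum of the martingales `S` and `-S`, hence a nonnegative submartingale. The
  -- `L¹` form of Doob's inequality suffices, followed by `E|S| ≤ √(E S²)` and the isometry.
  have hmax := maximal_ineq (hmart.submartingale.sup hmart.neg.submartingale)
    (fun i ω => abs_nonneg (gridSum W τ 0 β i ω)) (ε := ε) J
  have hset : {ω | ∃ j ≤ J, ε ≤ |gridSum W τ 0 β j ω|} = {ω | (ε : ℝ) ≤
      (Finset.range (J + 1)).sup' Finset.nonempty_range_add_one
        fun k => (gridSum W τ 0 β ⊔ -gridSum W τ 0 β) k ω} := by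
    ext ω
    simp [Finset.le_sup'_iff, abs]
  rw [← hset] at hmax
  have habs : ∀ ω, (gridSum W τ 0 β ⊔ -gridSum W τ 0 β) J ω = |gridSum W τ 0 β J ω| :=
    fun ω => rfl
  simp_rw [habs] at hmax
  have hint : ∫ ω in {ω | ∃ j ≤ J, ε ≤ |gridSum W τ 0 β j ω|}, |gridSum W τ 0 β J ω| ∂P
      ≤ √((τ J - τ 0) * B) := by
    refine (setIntegral_le_integral ((hS.memLp J).integrable (by norm_num)).abs
      (ae_of_all _ fun _ => abs_nonneg _)).trans ((integral_abs_le_sqrt (hS.memLp J)).trans ?_)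
    refine Real.sqrt_le_sqrt ?_
    rw [integral_gridSum_sq hW hτ hτT hβ]
    exact sum_grid_mul_le hτ hB J
  rw [ENNReal.ofReal_div_of_pos hε, ENNReal.le_div_iff_mul_le (Or.inl (by simpa using hε.ne'))
    (by simp),
    mul_comm, ENNReal.ofReal_coe_nnreal]
  exact hmax.trans (ENNReal.ofReal_le_ofReal hint)

end

/-! ### Euler schemes on nested grids and their `L²` estimates -/

section

variable {Ω : Type*} [mΩ : MeasurableSpace Ω]

lemma abs_sub_le_of_lipschitzWith {ψ : ℝ × ℝ → ℝ} {K : NNReal} (hψ : LipschitzWith K ψ)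
    (y y' v : ℝ) : |ψ (y, v) - ψ (y', v)| ≤ K * |y - y'| := by
  have := hψ.dist_le_mul (y, v) (y', v)
  simpa [Prod.dist_eq, Real.dist_eq] using this

lemma sq_sub_le_of_lipschitzWith {ψ : ℝ × ℝ → ℝ} {K : NNReal} (hψ : LipschitzWith K ψ)
    (y y' v : ℝ) : (ψ (y, v) - ψ (y', v)) ^ 2 ≤ K ^ 2 * (y - y') ^ 2 := by
  rw [← mul_pow, ← sq_abs, ← sq_abs (K * (y - y')), abs_mul, NNReal.abs_eq]
  exact pow_le_pow_left₀ (abs_nonneg _) (abs_sub_le_of_lipschitzWith hψ y y' v) 2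

lemma exists_sq_le_of_lipschitzWith {ψ : ℝ × ℝ → ℝ} {K : NNReal} (hψ : LipschitzWith K ψ)
    (M : ℝ) : ∃ L, 0 ≤ L ∧ ∀ y v, |v| ≤ M → ψ (y, v) ^ 2 ≤ L * (1 + y ^ 2) := by
  -- From `|ψ(y, v)| ≤ (|ψ(0,0)| + K M) + K |y|` and `(a + b)² ≤ 2 a² + 2 b²`.
  refine ⟨2 * (|ψ (0, 0)| + K * M) ^ 2 + 2 * K ^ 2, by positivity, fun y v hv => ?_⟩
  have h1 : |ψ (y, v)| ≤ (|ψ (0, 0)| + K * M) + K * |y| := by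
    have h := hψ.dist_le_mul (y, v) (0, 0)
    rw [Prod.dist_eq, Real.dist_eq, Real.dist_eq, Real.dist_eq, sub_zero, sub_zero] at h
    have hmax : max |y| |v| ≤ M + |y| := max_le (by linarith [abs_nonneg v]) (by
      linarith [abs_nonneg y])
    have := mul_le_mul_of_nonneg_left hmax K.coe_nonneg
    have h3 := abs_sub_abs_le_abs_sub (ψ (y, v)) (ψ (0, 0))
    linarith
  calc ψ (y, v) ^ 2 = |ψ (y, v)| ^ 2 := (sq_abs _).symm
    _ ≤ ((|ψ (0, 0)| + K * M) + K * |y|) ^ 2 := pow_le_pow_left₀ (abs_nonneg _) h1 2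
    _ ≤ 2 * ((|ψ (0, 0)| + K * M) ^ 2 + (K * |y|) ^ 2) := add_sq_le
    _ = 2 * (|ψ (0, 0)| + K * M) ^ 2 + 2 * K ^ 2 * y ^ 2 := by rw [mul_pow, sq_abs]; ring
    _ ≤ _ := by nlinarith [sq_nonneg (|ψ (0, 0)| + K * M), sq_nonneg (K : ℝ), sq_nonneg y,
        mul_nonneg (sq_nonneg (|ψ (0, 0)| + K * M)) (sq_nonneg y)]

/-- A sequence of nested grids of `[s, T]` of vanishing mesh, on whose cells `u` is constant. -/
structure StepGrid (s T : ℝ) (u : ℝ → ℝ) where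
  t : ℕ → ℕ → ℝ
  v : ℕ → ℕ → ℝ
  bound : ℝ
  mono : ∀ n, Monotone (t n)
  zero : ∀ n, t n 0 = s
  -- There are twice `2 ^ n` cells, leaving `2 ^ n` for each side of a jump of `u`. Past the last
  -- one the grid rests at `T`, so all later steps have length zero.
  last : ∀ n i, 2 ^ (n + 1) ≤ i → t n i = T
  refine : ∀ n i, t (n + 1) (2 * i) = t n i
  mesh : ∀ n i, t n (i + 1) - t n i ≤ (T - s) * (1 / 2) ^ n
  v_refine : ∀ n i, v (n + 1) i = v n (i / 2)
  v_eq : ∀ n i, ∀ r ∈ Ioc (t n i) (t n (i + 1)), u r = v n i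
  abs_v_le : ∀ n i, |v n i| ≤ bound
  abs_le : ∀ r, |u r| ≤ bound
  measurable : Measurable u

namespace StepGrid

section Euler

variable {s T : ℝ} {u : ℝ → ℝ} (G : StepGrid s T u)

lemma mem_Icc (n i : ℕ) : G.t n i ∈ Icc s T :=
  ⟨(G.zero n).symm.le.trans (G.mono n i.zero_le),
    (G.mono n (le_max_left i (2 ^ (n + 1)))).trans (G.last n _ (le_max_right _ _)).le⟩

include G in
lemma le : s ≤ T := (G.mem_Icc 0 0).1.trans (G.mem_Icc 0 0).2

lemma mem_Icc_zero (hs : 0 ≤ s) (n i : ℕ) : G.t n i ∈ Icc 0 T :=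
  ⟨hs.trans (G.mem_Icc n i).1, (G.mem_Icc n i).2⟩

lemma step_nonneg (n i : ℕ) : 0 ≤ G.t n (i + 1) - G.t n i := sub_nonneg.2 (G.mono n i.le_succ)

lemma step_le (n i : ℕ) : G.t n (i + 1) - G.t n i ≤ T - s :=
  (G.mesh n i).trans (mul_le_of_le_one_right (sub_nonneg.2 G.le)
    (pow_le_one₀ (by norm_num) (by norm_num)))

variable {Ω : Type*} (W : ℝ → Ω → ℝ) (b σ : ℝ × ℝ → ℝ) (x : ℝ)

/-- The Euler scheme for `dX = b(X, u) dt + σ(X, u) dW` along the `n`-th grid. -/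
def euler (n : ℕ) : ℕ → Ω → ℝ
  | 0 => fun _ => x
  | i + 1 => fun ω => euler n i ω + (b (euler n i ω, G.v n i) * (G.t n (i + 1) - G.t n i)
      + σ (euler n i ω, G.v n i) * (W (G.t n (i + 1)) ω - W (G.t n i) ω))

/-- A coefficient evaluated along the Euler scheme. -/
def coef (ψ : ℝ × ℝ → ℝ) (n i : ℕ) (ω : Ω) : ℝ := ψ (G.euler W b σ x n i ω, G.v n i)

variable {W b σ x}

lemma euler_eq (n j : ℕ) (ω : Ω) : G.euler W b σ x n j ω
    = x + gridSum W (G.t n) (G.coef W b σ x b n) (G.coef W b σ x σ n) j ω := by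
  induction j with
  | zero => simp [euler]
  | succ j ih => rw [euler, gridSum_succ, ← add_assoc, ← ih]; rfl

end Euler

variable {P : Measure Ω} [IsProbabilityMeasure P] {F : Filtration ℝ mΩ} {T : ℝ} {W : ℝ → Ω → ℝ}
  {s : ℝ} {u : ℝ → ℝ} (G : StepGrid s T u) {b σ : ℝ × ℝ → ℝ} {K : NNReal} {x : ℝ}

omit [IsProbabilityMeasure P] in
lemma memLp_comp_lipschitz [IsFiniteMeasure P] {ψ : ℝ × ℝ → ℝ} (hψ : LipschitzWith K ψ) {Y : Ω → ℝ}
    (hY : MemLp Y 2 P) (v : ℝ) : MemLp (fun ω => ψ (Y ω, v)) 2 P := by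
  have h1 : MemLp (fun ω => |Y ω|) 2 P := hY.norm
  have h0 : MemLp (fun ω => |ψ (0, v)| + K * |Y ω|) 2 P :=
    (memLp_const |ψ (0, v)|).add (h1.const_mul (K : ℝ))
  refine h0.mono' (hψ.continuous.comp_aestronglyMeasurable
    (hY.aestronglyMeasurable.prodMk aestronglyMeasurable_const)) (ae_of_all _ fun ω => ?_)
  have := abs_sub_le_of_lipschitzWith hψ (Y ω) 0 v
  rw [sub_zero] at this
  have h3 := abs_sub_abs_le_abs_sub (ψ (Y ω, v)) (ψ (0, v))
  rw [Real.norm_eq_abs]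
  linarith

lemma gridAdapted_euler (hW : IsBrownianOn P F T W) (hs : 0 ≤ s) (hb : LipschitzWith K b)
    (hσ : LipschitzWith K σ) (n : ℕ) : GridAdapted P F (G.t n) (G.euler W b σ x n) := by
  have key : ∀ j, Measurable[F (G.t n j)] (G.euler W b σ x n j) ∧
      MemLp (G.euler W b σ x n j) 2 P := by
    intro j
    induction j with
    | zero => exact ⟨measurable_const, memLp_const x⟩
    | succ j ih =>
      have h0 := G.mem_Icc_zero hs n
      have hle := F.mono (G.mono n j.le_succ)
      have hm : ∀ {ψ : ℝ × ℝ → ℝ}, LipschitzWith K ψ →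
          Measurable[F (G.t n j)] (fun ω => ψ (G.euler W b σ x n j ω, G.v n j)) := fun hψ =>
        hψ.continuous.measurable.comp (ih.1.prodMk measurable_const)
      have hd := hW.measurable_increment (h0 j).1 (G.mono n j.le_succ) (h0 (j + 1)).2
      have he : G.euler W b σ x n (j + 1) = fun ω => G.euler W b σ x n j ω
          + (b (G.euler W b σ x n j ω, G.v n j) * (G.t n (j + 1) - G.t n j)
          + σ (G.euler W b σ x n j ω, G.v n j) * (W (G.t n (j + 1)) ω - W (G.t n j) ω)) := rfl
      rw [he]
      refine ⟨(ih.1.mono hle le_rfl).add ((((hm hb).mono hle le_rfl).mul_const _).add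
        (((hm hσ).mono hle le_rfl).mul hd)), ih.2.add ?_⟩
      exact ((memLp_comp_lipschitz hb ih.2 _).mul_const _).add
        (hW.memLp_mul_increment (h0 j).1 (G.mono n j.le_succ) (h0 (j + 1)).2 (hm hσ)
          (memLp_comp_lipschitz hσ ih.2 _))
  exact ⟨fun j => (key j).1, fun j => (key j).2⟩

lemma gridAdapted_coef (hW : IsBrownianOn P F T W) (hs : 0 ≤ s) (hb : LipschitzWith K b)
    (hσ : LipschitzWith K σ) {ψ : ℝ × ℝ → ℝ} (hψ : LipschitzWith K ψ) (n : ℕ) :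
    GridAdapted P F (G.t n) (G.coef W b σ x ψ n) :=
  have h := G.gridAdapted_euler hW hs hb hσ n
  ⟨fun i => hψ.continuous.measurable.comp ((h.meas i).prodMk measurable_const),
    fun i => memLp_comp_lipschitz hψ (h.memLp i) _⟩

lemma integral_coef_sq_le (hW : IsBrownianOn P F T W) (hs : 0 ≤ s) (hb : LipschitzWith K b)
    (hσ : LipschitzWith K σ) {ψ : ℝ × ℝ → ℝ} (hψ : LipschitzWith K ψ) {L : ℝ}
    (hL : ∀ y v, |v| ≤ G.bound → ψ (y, v) ^ 2 ≤ L * (1 + y ^ 2)) (n i : ℕ) :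
    ∫ ω, G.coef W b σ x ψ n i ω ^ 2 ∂P ≤ L * (1 + ∫ ω, G.euler W b σ x n i ω ^ 2 ∂P) := by
  have hX := ((G.gridAdapted_euler (x := x) hW hs hb hσ n).memLp i).integrable_sq
  have h1 : Integrable (fun ω => 1 + G.euler W b σ x n i ω ^ 2) P := (integrable_const 1).add hX
  have : 1 + ∫ ω, G.euler W b σ x n i ω ^ 2 ∂P = ∫ ω, (1 + G.euler W b σ x n i ω ^ 2) ∂P := by
    rw [integral_add (integrable_const 1) hX]; simp
  rw [this, ← integral_const_mul]
  exact integral_mono ((G.gridAdapted_coef hW hs hb hσ hψ n).memLp i).integrable_sq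
    (h1.const_mul L) fun ω => hL _ _ (G.abs_v_le n i)

/-- The Euler schemes are bounded in `L²`, uniformly in the grid. -/
lemma exists_integral_euler_sq_le (hW : IsBrownianOn P F T W) (hs : 0 ≤ s)
    (hb : LipschitzWith K b) (hσ : LipschitzWith K σ) (x : ℝ) :
    ∃ C, 0 ≤ C ∧ ∀ n j, ∫ ω, G.euler W b σ x n j ω ^ 2 ∂P ≤ C := by
  obtain ⟨L₁, hL₁0, hL₁⟩ := exists_sq_le_of_lipschitzWith hb G.bound
  obtain ⟨L₂, hL₂0, hL₂⟩ := exists_sq_le_of_lipschitzWith hσ G.bound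
  have hD := sub_nonneg.2 G.le
  set D := T - s with hDdef
  -- Linear growth turns one step into `E_{j+1} ≤ (1 + Δ) E_j + Δ B (1 + E_j)`, so Gronwall applies
  -- with rate `1 + B`.
  set B := (1 + D) * L₁ + L₂ with hB
  have hB0 : 0 ≤ B := by positivity
  refine ⟨(x ^ 2 + B * D) * Real.exp ((1 + B) * D), by positivity, fun n j => ?_⟩
  have hE := G.gridAdapted_euler (x := x) hW hs hb hσ n
  have h0 := G.mem_Icc_zero hs n
  have key := discrete_gronwall (G.mono n) (E := fun j => ∫ ω, G.euler W b σ x n j ω ^ 2 ∂P)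
    (B := B) (C := 1 + B) hB0 (by positivity) (integral_nonneg fun ω => sq_nonneg _) ?_ j
  · have hle : G.t n j - G.t n 0 ≤ D := by
      rw [G.zero]; linarith [(G.mem_Icc n j).2]
    have hnn : 0 ≤ G.t n j - G.t n 0 := sub_nonneg.2 (G.mono n j.zero_le)
    refine key.trans ?_
    simp only [euler, integral_const, probReal_univ, one_smul]
    gcongr
  · intro j
    have hstep := hW.integral_step_sq_le (h0 j).1 (G.mono n j.le_succ) (h0 (j + 1)).2
      (hE.meas j) (hE.memLp j) ((G.gridAdapted_coef (x := x) hW hs hb hσ hb n).meas j)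
      ((G.gridAdapted_coef (x := x) hW hs hb hσ hb n).memLp j)
      ((G.gridAdapted_coef (x := x) hW hs hb hσ hσ n).meas j)
      ((G.gridAdapted_coef (x := x) hW hs hb hσ hσ n).memLp j)
    have h1 := G.integral_coef_sq_le (x := x) hW hs hb hσ hb hL₁ n j
    have h2 := G.integral_coef_sq_le (x := x) hW hs hb hσ hσ hL₂ n j
    have hΔ0 := G.step_nonneg n j
    have hΔ := G.step_le n j
    have hEnn : 0 ≤ ∫ ω, G.euler W b σ x n j ω ^ 2 ∂P := integral_nonneg fun ω => sq_nonneg _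
    refine hstep.trans ?_
    set Δ := G.t n (j + 1) - G.t n j
    set E := ∫ ω, G.euler W b σ x n j ω ^ 2 ∂P
    have h3 : (1 + Δ) * ∫ ω, G.coef W b σ x b n j ω ^ 2 ∂P
        ≤ (1 + D) * (L₁ * (1 + E)) :=
      mul_le_mul (by linarith) h1 (integral_nonneg fun ω => sq_nonneg _) (by positivity)
    have h4 : Δ * ((1 + Δ) * ∫ ω, G.coef W b σ x b n j ω ^ 2 ∂P
        + ∫ ω, G.coef W b σ x σ n j ω ^ 2 ∂P) ≤ Δ * (B * (1 + E)) :=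
      mul_le_mul_of_nonneg_left (by rw [hB]; linarith) hΔ0
    linarith

/-- Successive Euler schemes are close in `L²` at the points of the finer grid. -/
lemma exists_integral_euler_succ_sub_sq_le (hW : IsBrownianOn P F T W) (hs : 0 ≤ s)
    (hb : LipschitzWith K b) (hσ : LipschitzWith K σ) (x : ℝ) :
    ∃ C, 0 ≤ C ∧ ∀ n j,
      ∫ ω, (G.euler W b σ x (n + 1) j ω - G.euler W b σ x n (j / 2) ω) ^ 2 ∂P
        ≤ C * (1 / 2) ^ n := by
  obtain ⟨L₁, hL₁0, hL₁⟩ := exists_sq_le_of_lipschitzWith hb G.bound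
  obtain ⟨L₂, hL₂0, hL₂⟩ := exists_sq_le_of_lipschitzWith hσ G.bound
  obtain ⟨C₀, hC₀, hmom⟩ := G.exists_integral_euler_sq_le hW hs hb hσ x
  have hD := sub_nonneg.2 G.le
  set D := T - s with hDdef
  -- `B` bounds the squared coefficients, which governs the motion within half a cell. `A` is the
  -- Lipschitz analogue, which governs the growth of the error.
  set B := (1 + D) * (L₁ * (1 + C₀)) + L₂ * (1 + C₀) with hB
  set A := (1 + D) * (K : ℝ) ^ 2 + (K : ℝ) ^ 2 with hA
  have hB0 : 0 ≤ B := by positivity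
  have hA0 : 0 ≤ A := by positivity
  refine ⟨2 * (A * (2 * (D * B)) * D * Real.exp ((1 + 2 * A) * D)) + 2 * (D * B), by positivity,
    fun n => ?_⟩
  have hmono := G.mono (n + 1)
  have h0 := G.mem_Icc_zero hs (n + 1)
  have hadp : ∀ {ψ}, LipschitzWith K ψ →
      GridAdapted P F (G.t (n + 1)) (fun i => G.coef W b σ x ψ n (i / 2)) := fun hψ =>
    (G.gridAdapted_coef hW hs hb hσ hψ n).refine (G.refine n) hmono
  have hadp' : ∀ {ψ}, LipschitzWith K ψ →
      GridAdapted P F (G.t (n + 1)) (G.coef W b σ x ψ (n + 1)) := fun hψ =>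
    G.gridAdapted_coef hW hs hb hσ hψ (n + 1)
  -- `x + Y` is the coarse scheme continued to the fine grid with frozen coefficients. It agrees
  -- with the coarse scheme at even indices and is half a coarse step ahead at odd ones.
  set Y : ℕ → Ω → ℝ := gridSum W (G.t (n + 1)) (fun i => G.coef W b σ x b n (i / 2))
    (fun i => G.coef W b σ x σ n (i / 2)) with hY
  set α := G.coef W b σ x b (n + 1) - fun i => G.coef W b σ x b n (i / 2) with hα
  set β := G.coef W b σ x σ (n + 1) - fun i => G.coef W b σ x σ n (i / 2) with hβ
  set e : ℕ → Ω → ℝ := gridSum W (G.t (n + 1)) α β with he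
  have hαa : GridAdapted P F (G.t (n + 1)) α := (hadp' hb).sub (hadp hb)
  have hβa : GridAdapted P F (G.t (n + 1)) β := (hadp' hσ).sub (hadp hσ)
  have hea : GridAdapted P F (G.t (n + 1)) e := GridAdapted.gridSum hW hmono h0 hαa hβa
  have hXa := G.gridAdapted_euler (x := x) hW hs hb hσ n
  have hXa' := G.gridAdapted_euler (x := x) hW hs hb hσ (n + 1)
  have hYa : GridAdapted P F (G.t (n + 1)) Y :=
    GridAdapted.gridSum hW hmono h0 (hadp hb) (hadp hσ)
  have hYeven : ∀ i ω, x + Y (2 * i) ω = G.euler W b σ x n i ω := fun i ω => by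
    rw [G.euler_eq, hY, gridSum_refine two_pos (G.refine n)]
  have hhalf : ∀ j, ∫ ω, (x + Y j ω - G.euler W b σ x n (j / 2) ω) ^ 2 ∂P
      ≤ D * B * (1 / 2) ^ n := by
    intro j
    obtain ⟨i, rfl | rfl⟩ := Nat.even_or_odd' j
    · rw [Nat.mul_div_cancel_left _ two_pos]
      simp only [hYeven, sub_self]
      simp only [ne_eq, OfNat.ofNat_ne_zero, not_false_eq_true, zero_pow, integral_zero]
      positivity
    · have hdiv : (2 * i + 1) / 2 = i := by lia
      have hdiv' : (2 * i) / 2 = i := by lia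
      have hstep := hW.integral_step_sq_le (h0 (2 * i)).1 (hmono (2 * i).le_succ)
        (h0 (2 * i + 1)).2 (A := fun _ => 0) measurable_const MemLp.zero
        ((hadp hb).meas (2 * i)) ((hadp hb).memLp (2 * i)) ((hadp hσ).meas (2 * i))
        ((hadp hσ).memLp (2 * i))
      have heq : ∀ ω, x + Y (2 * i + 1) ω - G.euler W b σ x n ((2 * i + 1) / 2) ω
          = 0 + (G.coef W b σ x b n (2 * i / 2) ω * (G.t (n + 1) (2 * i + 1) - G.t (n + 1) (2 * i))
            + G.coef W b σ x σ n (2 * i / 2) ω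
              * (W (G.t (n + 1) (2 * i + 1)) ω - W (G.t (n + 1) (2 * i)) ω)) := fun ω => by
        rw [hdiv, ← hYeven, hY, gridSum_succ]; ring
      simp_rw [heq]
      refine hstep.trans ?_
      have h1 := (G.integral_coef_sq_le (x := x) hW hs hb hσ hb hL₁ n (2 * i / 2)).trans
        (mul_le_mul_of_nonneg_left (add_le_add_right (hmom n _) 1) hL₁0)
      have h2 := (G.integral_coef_sq_le (x := x) hW hs hb hσ hσ hL₂ n (2 * i / 2)).trans
        (mul_le_mul_of_nonneg_left (add_le_add_right (hmom n _) 1) hL₂0)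
      have hΔ0 := G.step_nonneg (n + 1) (2 * i)
      have hΔ := G.step_le (n + 1) (2 * i)
      have hmesh : G.t (n + 1) (2 * i + 1) - G.t (n + 1) (2 * i) ≤ D * (1 / 2) ^ n :=
        (G.mesh (n + 1) (2 * i)).trans (mul_le_mul_of_nonneg_left
          (pow_le_pow_of_le_one (by norm_num) (by norm_num) n.le_succ) hD)
      set Δ := G.t (n + 1) (2 * i + 1) - G.t (n + 1) (2 * i)
      have h3 := mul_le_mul (add_le_add_right hΔ 1) h1 (integral_nonneg fun ω => sq_nonneg _)
        (by positivity)
      have h4 := mul_le_mul hmesh (add_le_add h3 h2) (add_nonneg (mul_nonneg (by linarith)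
        (integral_nonneg fun ω => sq_nonneg _)) (integral_nonneg fun ω => sq_nonneg _))
        (by positivity)
      simp only [ne_eq, OfNat.ofNat_ne_zero, not_false_eq_true, zero_pow, integral_zero, mul_zero,
        zero_add]
      refine h4.trans (le_of_eq ?_)
      rw [hB]; ring
  have hediff : ∀ j ω, e j ω = G.euler W b σ x (n + 1) j ω - (x + Y j ω) := fun j ω => by
    rw [he, hα, hβ, gridSum_sub, G.euler_eq]; ring
  -- The error is split into `e`, the fine scheme minus the continued coarse one, and the half-step
  -- motion, which is already `O(2^{-n})`.
  have hδ : ∀ j, ∫ ω, (G.euler W b σ x (n + 1) j ω - G.euler W b σ x n (j / 2) ω) ^ 2 ∂P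
      ≤ 2 * ∫ ω, e j ω ^ 2 ∂P + 2 * (D * B * (1 / 2) ^ n) := by
    intro j
    have hi1 := (hea.memLp j).integrable_sq.const_mul 2
    have hi2 : Integrable (fun ω => 2 * (x + Y j ω - G.euler W b σ x n (j / 2) ω) ^ 2) P :=
      ((((memLp_const x).add (hYa.memLp j)).sub (hXa.memLp (j / 2))).integrable_sq).const_mul 2
    have h1 : ∫ ω, (G.euler W b σ x (n + 1) j ω - G.euler W b σ x n (j / 2) ω) ^ 2 ∂P
        ≤ ∫ ω, (2 * e j ω ^ 2 + 2 * (x + Y j ω - G.euler W b σ x n (j / 2) ω) ^ 2) ∂P := by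
      refine integral_mono ((hXa'.memLp j).sub (hXa.memLp (j / 2))).integrable_sq (hi1.add hi2)
        fun ω => ?_
      have : G.euler W b σ x (n + 1) j ω - G.euler W b σ x n (j / 2) ω
          = e j ω + (x + Y j ω - G.euler W b σ x n (j / 2) ω) := by rw [hediff]; ring
      simp only [this]
      nlinarith [sq_nonneg (e j ω - (x + Y j ω - G.euler W b σ x n (j / 2) ω))]
    rw [integral_add hi1 hi2, integral_const_mul, integral_const_mul] at h1
    linarith [hhalf j]
  have hcoef : ∀ {ψ}, LipschitzWith K ψ → ∀ j,
      ∫ ω, (G.coef W b σ x ψ (n + 1) j ω - G.coef W b σ x ψ n (j / 2) ω) ^ 2 ∂P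
      ≤ K ^ 2 * ∫ ω, (G.euler W b σ x (n + 1) j ω - G.euler W b σ x n (j / 2) ω) ^ 2 ∂P := by
    intro ψ hψ j
    rw [← integral_const_mul]
    refine integral_mono (((hadp' hψ).sub (hadp hψ)).memLp j).integrable_sq
      (((hXa'.memLp j).sub (hXa.memLp (j / 2))).integrable_sq.const_mul _) fun ω => ?_
    simp only [coef, G.v_refine]
    exact sq_sub_le_of_lipschitzWith hψ _ _ _
  intro j
  -- The increments of `e` are controlled through the Lipschitz bounds by the full error, hence by
  -- `2 E e²` plus `O(2^{-n})`. This closes the recursion with rate `1 + 2 A`.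
  have key := discrete_gronwall hmono (E := fun j => ∫ ω, e j ω ^ 2 ∂P)
    (B := A * (2 * (D * B * (1 / 2) ^ n))) (C := 1 + 2 * A) (by positivity) (by positivity)
    (integral_nonneg fun ω => sq_nonneg _) ?_ j
  · have hle : G.t (n + 1) j - G.t (n + 1) 0 ≤ D := by
      rw [G.zero]; linarith [(G.mem_Icc (n + 1) j).2]
    have hnn : 0 ≤ G.t (n + 1) j - G.t (n + 1) 0 := sub_nonneg.2 (hmono j.zero_le)
    have e0 : ∫ ω, e 0 ω ^ 2 ∂P = 0 := by simp [he]
    have h2 : ∫ ω, e j ω ^ 2 ∂P ≤ (0 + A * (2 * (D * B * (1 / 2) ^ n)) * D)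
        * Real.exp ((1 + 2 * A) * D) := by
      refine key.trans ?_
      simp only [e0]
      gcongr
    refine (hδ j).trans ?_
    linarith
  · intro j
    have hstep := hW.integral_step_sq_le (h0 j).1 (hmono j.le_succ) (h0 (j + 1)).2
      (hea.meas j) (hea.memLp j) (hαa.meas j) (hαa.memLp j) (hβa.meas j) (hβa.memLp j)
    have hesucc : ∀ ω, e (j + 1) ω = e j ω + (α j ω * (G.t (n + 1) (j + 1) - G.t (n + 1) j)
        + β j ω * (W (G.t (n + 1) (j + 1)) ω - W (G.t (n + 1) j) ω)) := fun ω => gridSum_succ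
    simp_rw [hesucc]
    refine hstep.trans ?_
    have h1 := (hcoef hb j).trans (mul_le_mul_of_nonneg_left (hδ j) (sq_nonneg (K : ℝ)))
    have h2 := (hcoef hσ j).trans (mul_le_mul_of_nonneg_left (hδ j) (sq_nonneg (K : ℝ)))
    have hΔ0 := G.step_nonneg (n + 1) j
    have hΔ := G.step_le (n + 1) j
    set Δ := G.t (n + 1) (j + 1) - G.t (n + 1) j
    have h3 := mul_le_mul (add_le_add_right hΔ 1) h1 (integral_nonneg fun ω => sq_nonneg _)
      (by positivity)
    have h4 := mul_le_mul_of_nonneg_left (add_le_add h3 h2) hΔ0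
    simp only [hα, hβ, Pi.sub_apply]
    refine (add_le_add_right h4 _).trans (le_of_eq ?_)
    rw [hA]; ring

end StepGrid

end

/-! ### Almost sure uniform convergence of the Euler schemes -/

section

variable {Ω : Type*} [mΩ : MeasurableSpace Ω]

/-- A sequence of continuous functions whose increments decay geometrically, uniformly on `S`,
converges uniformly on `S` to a continuous function. -/
lemma exists_tendstoUniformlyOn_of_geometric {f : ℕ → ℝ → ℝ} {S : Set ℝ} {C r : ℝ} (hr : r < 1)
    (hr0 : 0 ≤ r) (hf : ∀ n, ContinuousOn (f n) S)
    (h : ∀ᶠ n in atTop, ∀ t ∈ S, |f (n + 1) t - f n t| ≤ C * r ^ n) :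
    ∃ l : ℝ → ℝ, ContinuousOn l S ∧ TendstoUniformlyOn f l atTop S := by
  obtain ⟨N, hN⟩ := eventually_atTop.1 h
  have hd : ∀ t ∈ S, ∀ n, dist (f (n + N) t) (f (n + 1 + N) t) ≤ C * r ^ N * r ^ n :=
    fun t ht n => by
      rw [dist_comm, Real.dist_eq, add_right_comm]
      refine (hN (n + N) (Nat.le_add_left _ _) t ht).trans (le_of_eq ?_)
      rw [pow_add]; ring
  have hlim : ∀ t ∈ S, ∃ l, Tendsto (fun n => f (n + N) t) atTop (𝓝 l) := fun t ht =>
    cauchySeq_tendsto_of_complete (cauchySeq_of_le_geometric r _ hr (hd t ht))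
  choose! l hl using hlim
  have hunif : TendstoUniformlyOn f l atTop S := by
    rw [Metric.tendstoUniformlyOn_iff]
    intro ε hε
    have h0 : Tendsto (fun n => C * r ^ N * r ^ n / (1 - r)) atTop (𝓝 0) := by
      simpa using ((tendsto_pow_atTop_nhds_zero_of_lt_one hr0 hr).const_mul
        (C * r ^ N)).div_const (1 - r)
    obtain ⟨M, hM⟩ := eventually_atTop.1 (h0.eventually (gt_mem_nhds hε))
    filter_upwards [eventually_ge_atTop (M + N)] with n hn t ht
    obtain ⟨k, rfl⟩ := Nat.exists_eq_add_of_le' (le_of_add_le_right hn)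
    rw [dist_comm]
    exact (dist_le_of_le_geometric_of_tendsto r _ hr (hd t ht) (hl t ht) k).trans_lt
      (hM k (by lia))
  exact ⟨l, hunif.continuousOn (Frequently.of_forall hf), hunif⟩

namespace StepGrid

section Index

variable {s T : ℝ} {u : ℝ → ℝ} (G : StepGrid s T u)

/-- The index of the last point of the `n`-th grid before `t`. -/
def idx (n : ℕ) (t : ℝ) : ℕ := Nat.findGreatest (fun i => G.t n i ≤ t) (2 ^ (n + 1))

lemma idx_le (n : ℕ) (t : ℝ) : G.idx n t ≤ 2 ^ (n + 1) := Nat.findGreatest_le _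

lemma t_idx_le (n : ℕ) {t : ℝ} (ht : s ≤ t) : G.t n (G.idx n t) ≤ t :=
  Nat.findGreatest_spec (P := fun i => G.t n i ≤ t) (Nat.zero_le _) ((G.zero n).trans_le ht)

lemma lt_of_idx_lt {n i : ℕ} {t : ℝ} (h : G.idx n t < i) (hi : i ≤ 2 ^ (n + 1)) : t < G.t n i :=
  not_le.1 (Nat.findGreatest_is_greatest h hi)

lemma le_t_idx_succ (n : ℕ) {t : ℝ} (ht : t ≤ T) : t ≤ G.t n (G.idx n t + 1) := by
  rcases (G.idx_le n t).lt_or_eq with h | h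
  · exact (G.lt_of_idx_lt (Nat.lt_succ_self _) h).le
  · rw [h, G.last _ _ (Nat.le_succ _)]; exact ht

lemma idx_eq {n i : ℕ} {t : ℝ} (hi : i < 2 ^ (n + 1)) (ht : t ∈ Ico (G.t n i) (G.t n (i + 1))) :
    G.idx n t = i := by
  refine (Nat.findGreatest_eq_iff).2 ⟨hi.le, fun _ => ht.1, fun k hk _ => not_le.2 ?_⟩
  exact ht.2.trans_le (G.mono n hk)

/-- Coarse grid points are the fine ones of even index. This matches the pairing of `j` with `j / 2`
in the `L²` estimate for successive schemes. -/
lemma idx_succ_div_two (n : ℕ) {t : ℝ} (ht : s ≤ t) : G.idx (n + 1) t / 2 = G.idx n t := by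
  have h1 := G.idx_le (n + 1) t
  rw [pow_succ] at h1
  refine ((Nat.findGreatest_eq_iff).2 ⟨by lia, fun _ => ?_, fun k hk hk2 => not_le.2 ?_⟩).symm
  · rw [← G.refine]
    exact (G.mono _ (Nat.mul_div_le _ _)).trans (G.t_idx_le (n + 1) ht)
  · rw [← G.refine]
    exact G.lt_of_idx_lt (by lia) (by rw [pow_succ]; lia)

lemma tendsto_t_idx {t : ℝ} (ht : t ∈ Icc s T) :
    Tendsto (fun n => G.t n (G.idx n t)) atTop (𝓝 t) := by
  have h0 : Tendsto (fun n : ℕ => t - (T - s) * (1 / 2 : ℝ) ^ n) atTop (𝓝 t) := by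
    simpa using ((tendsto_pow_atTop_nhds_zero_of_lt_one (r := (1 / 2 : ℝ)) (by norm_num)
      (by norm_num)).const_mul (T - s)).const_sub t
  refine tendsto_of_tendsto_of_tendsto_of_le_of_le h0 tendsto_const_nhds (fun n => ?_)
    fun n => G.t_idx_le n ht.1
  have h1 := G.le_t_idx_succ n ht.2
  have h2 := G.mesh n (G.idx n t)
  simp only
  linarith

lemma measurable_idx (n : ℕ) : Measurable (G.idx n) :=
  measurable_findGreatest fun _ _ => measurableSet_Ici

lemma refine_pow (n k i : ℕ) : G.t (n + k) (2 ^ k * i) = G.t n i := by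
  induction k with
  | zero => simp
  | succ k ih => rw [← ih, ← G.refine (n + k)]; congr 1; ring

end Index

section Interpolation

variable {s T : ℝ} {u : ℝ → ℝ} (G : StepGrid s T u) {Ω : Type*} (W : ℝ → Ω → ℝ)
  (b σ : ℝ × ℝ → ℝ) (x : ℝ)

/-- The continuous interpolation of the Euler scheme along the Brownian path. -/
def interp (n : ℕ) (t : ℝ) (ω : Ω) : ℝ :=
  x + gridSum W (fun i => min (G.t n i) t) (G.coef W b σ x b n) (G.coef W b σ x σ n)
    (2 ^ (n + 1)) ω

/-- The difference of a coefficient along successive Euler schemes. -/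
def coefDiff (ψ : ℝ × ℝ → ℝ) (n : ℕ) : ℕ → Ω → ℝ :=
  G.coef W b σ x ψ (n + 1) - fun i => G.coef W b σ x ψ n (i / 2)

variable {W b σ x}

lemma interp_grid {n j : ℕ} (hj : j ≤ 2 ^ (n + 1)) (ω : Ω) :
    G.interp W b σ x n (G.t n j) ω = G.euler W b σ x n j ω := by
  rw [interp, gridSum_min (G.mono n) hj, G.euler_eq]

lemma continuousOn_interp (hs : 0 ≤ s) (n : ℕ) {ω : Ω}
    (hW : ContinuousOn (fun t => W t ω) (Icc 0 T)) :
    ContinuousOn (fun t => G.interp W b σ x n t ω) (Icc s T) :=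
  continuousOn_const.add (continuousOn_gridSum_min hs (G.mem_Icc_zero hs n) hW)

/-- The coarse interpolation is rewritten on the fine grid, so that the difference becomes a single
sum with small coefficients. -/
lemma interp_succ_sub (n : ℕ) (t : ℝ) (ω : Ω) :
    G.interp W b σ x (n + 1) t ω - G.interp W b σ x n t ω
      = gridSum W (fun i => min (G.t (n + 1) i) t) (G.coefDiff W b σ x b n)
        (G.coefDiff W b σ x σ n) (2 ^ (n + 2)) ω := by
  rw [coefDiff, coefDiff, gridSum_sub, interp, interp,
    ← gridSum_refine (τ' := fun i => min (G.t (n + 1) i) t) two_pos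
      (fun i => by rw [G.refine]) (τ := fun i => min (G.t n i) t)]
  have : 2 * 2 ^ (n + 1) = 2 ^ (n + 2) := by ring
  rw [this]
  ring

/-- Grids `k` levels finer are needed to see the interpolations between their own grid points. The
coefficients stay constant on blocks of `2 ^ k` cells, so the bounds do not depend on `k`. -/
lemma interp_succ_sub_grid {n k j : ℕ} (hj : j ≤ 2 ^ (n + 2 + k)) (ω : Ω) :
    G.interp W b σ x (n + 1) (G.t (n + 1 + k) j) ω - G.interp W b σ x n (G.t (n + 1 + k) j) ω
      = gridSum W (G.t (n + 1 + k)) (fun i => G.coefDiff W b σ x b n (i / 2 ^ k))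
        (fun i => G.coefDiff W b σ x σ n (i / 2 ^ k)) j ω := by
  rw [interp_succ_sub, ← gridSum_min (G.mono _) hj,
    ← gridSum_refine (τ' := fun i => min (G.t (n + 1 + k) i) (G.t (n + 1 + k) j))
      (r := 2 ^ k) (by positivity) (fun i => by rw [G.refine_pow])]
  congr 1
  ring

end Interpolation

variable {P : Measure Ω} [IsProbabilityMeasure P] {F : Filtration ℝ mΩ} {T : ℝ} {W : ℝ → Ω → ℝ}
  {s : ℝ} {u : ℝ → ℝ} (G : StepGrid s T u) {b σ : ℝ × ℝ → ℝ} {K : NNReal} {x : ℝ}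

lemma gridAdapted_coefDiff (hW : IsBrownianOn P F T W) (hs : 0 ≤ s) (hb : LipschitzWith K b)
    (hσ : LipschitzWith K σ) {ψ : ℝ × ℝ → ℝ} (hψ : LipschitzWith K ψ) (n : ℕ) :
    GridAdapted P F (G.t (n + 1)) (G.coefDiff W b σ x ψ n) :=
  (G.gridAdapted_coef hW hs hb hσ hψ (n + 1)).sub
    ((G.gridAdapted_coef hW hs hb hσ hψ n).refine (G.refine n) (G.mono _))

lemma integral_coefDiff_sq_le (hW : IsBrownianOn P F T W) (hs : 0 ≤ s) (hb : LipschitzWith K b)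
    (hσ : LipschitzWith K σ) {ψ : ℝ × ℝ → ℝ} (hψ : LipschitzWith K ψ) (n j : ℕ) :
    ∫ ω, G.coefDiff W b σ x ψ n j ω ^ 2 ∂P ≤ K ^ 2 *
      ∫ ω, (G.euler W b σ x (n + 1) j ω - G.euler W b σ x n (j / 2) ω) ^ 2 ∂P := by
  rw [← integral_const_mul]
  refine integral_mono ((G.gridAdapted_coefDiff hW hs hb hσ hψ n).memLp j).integrable_sq
    ((((G.gridAdapted_euler hW hs hb hσ (n + 1)).memLp j).sub
      ((G.gridAdapted_euler hW hs hb hσ n).memLp (j / 2))).integrable_sq.const_mul _) fun ω => ?_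
  simp only [coefDiff, coef, G.v_refine, Pi.sub_apply]
  exact sq_sub_le_of_lipschitzWith hψ _ _ _

/-- A maximal inequality for the difference of successive interpolated Euler schemes. -/
lemma measure_exists_interp_succ_sub_le (hW : IsBrownianOn P F T W) (hs : 0 ≤ s)
    (hb : LipschitzWith K b) (hσ : LipschitzWith K σ) {n : ℕ} {B ε : ℝ} (hε : 0 < ε)
    (hBb : ∀ j, ∫ ω, G.coefDiff W b σ x b n j ω ^ 2 ∂P ≤ B)
    (hBσ : ∀ j, ∫ ω, G.coefDiff W b σ x σ n j ω ^ 2 ∂P ≤ B) :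
    P {ω | ∃ k j, j ≤ 2 ^ (n + 2 + k) ∧ 2 * ε ≤ |G.interp W b σ x (n + 1) (G.t (n + 1 + k) j) ω
        - G.interp W b σ x n (G.t (n + 1 + k) j) ω|}
      ≤ ENNReal.ofReal (((T - s) * √B + √((T - s) * B)) / ε) := by
  have hD := sub_nonneg.2 G.le
  have hB0 : 0 ≤ B := (integral_nonneg fun ω => sq_nonneg _).trans (hBb 0)
  set α := G.coefDiff W b σ x b n
  set β := G.coefDiff W b σ x σ n
  have hα : GridAdapted P F (G.t (n + 1)) α := G.gridAdapted_coefDiff hW hs hb hσ hb n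
  have hβ : GridAdapted P F (G.t (n + 1)) β := G.gridAdapted_coefDiff hW hs hb hσ hσ n
  -- The threshold `2 ε` is shared between drift and martingale part. `A` dominates the drift for
  -- all `k` and `j` at once, and `Bs k` is the exceptional event of the martingale part on the
  -- `k`-th refinement.
  set A : Ω → ℝ := gridSum W (G.t (n + 1)) (fun i ω => |α i ω|) 0 (2 ^ (n + 2)) with hA
  set Bs : ℕ → Set Ω := fun k => {ω | ∃ j ≤ 2 ^ (n + 2 + k),
    ε ≤ |gridSum W (G.t (n + 1 + k)) 0 (fun i => β (i / 2 ^ k)) j ω|} with hBs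
  have hsub : {ω | ∃ k j, j ≤ 2 ^ (n + 2 + k) ∧ 2 * ε ≤
      |G.interp W b σ x (n + 1) (G.t (n + 1 + k) j) ω
        - G.interp W b σ x n (G.t (n + 1 + k) j) ω|} ⊆ {ω | ε ≤ A ω} ∪ ⋃ k, Bs k := by
    rintro ω ⟨k, j, hj, h⟩
    rw [G.interp_succ_sub_grid hj, gridSum_split] at h
    have hAj : |gridSum W (G.t (n + 1 + k)) (fun i => α (i / 2 ^ k)) 0 j ω| ≤ A ω := by
      refine (abs_gridSum_drift_le (G.mono _) hj).trans (le_of_eq ?_)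
      have := gridSum_refine (W := W) (τ := G.t (n + 1)) (τ' := G.t (n + 1 + k))
        (α := fun i ω => |α i ω|) (β := 0) (j := 2 ^ (n + 2)) (ω := ω) (r := 2 ^ k)
        (by positivity) (G.refine_pow (n + 1) k)
      rw [hA, ← this, pow_add _ (n + 2), mul_comm]
      rfl
    by_contra hcon
    simp only [mem_union, mem_ofPred_eq, mem_iUnion, not_or, not_exists, hBs, not_and, not_le]
      at hcon
    have := abs_add_le (gridSum W (G.t (n + 1 + k)) (fun i => α (i / 2 ^ k)) 0 j ω)
      (gridSum W (G.t (n + 1 + k)) 0 (fun i => β (i / 2 ^ k)) j ω)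
    linarith [hcon.1, hcon.2 k j hj]
  -- As the grids are nested, these events increase with `k`. The probability of their union is
  -- therefore the supremum, and one Doob bound covers it.
  have hBmono : Monotone Bs := by
    refine monotone_nat_of_le_succ fun k => ?_
    rintro ω ⟨j, hj, h⟩
    refine ⟨2 * j, by rw [← add_assoc, pow_succ]; lia, ?_⟩
    have := gridSum_refine (W := W) (τ := G.t (n + 1 + k)) (τ' := G.t (n + 1 + (k + 1)))
        (α := 0) (β := fun i => β (i / 2 ^ k)) (j := j) (ω := ω) two_pos (G.refine (n + 1 + k))
    simp only [Nat.div_div_eq_div_mul, ← pow_succ'] at this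
    rw [← this] at h
    exact h
  have hBle : P (⋃ k, Bs k) ≤ ENNReal.ofReal (√((T - s) * B) / ε) := by
    rw [hBmono.measure_iUnion]
    refine iSup_le fun k => ?_
    refine (measure_exists_le_abs_gridSum_le hW (G.mono _) (G.mem_Icc_zero hs _)
      (hβ.refine (G.refine_pow (n + 1) k) (G.mono _)) (fun i => hBσ _) hε _).trans ?_
    refine ENNReal.ofReal_le_ofReal ?_
    gcongr
    · exact (G.mem_Icc _ _).2
    · exact (G.zero _).ge
  have hAeq : A = fun ω => ∑ i ∈ Finset.range (2 ^ (n + 2)),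
      |α i ω| * (G.t (n + 1) (i + 1) - G.t (n + 1) i) := by
    ext ω; simp [hA, gridSum]
  have hi : ∀ i, Integrable (fun ω => |α i ω| * (G.t (n + 1) (i + 1) - G.t (n + 1) i)) P :=
    fun i => ((hα.memLp i).integrable (by norm_num)).abs.mul_const _
  have hAi : Integrable A P := by
    rw [hAeq]
    exact integrable_finsetSum _ fun i _ => hi i
  have hAint : ∫ ω, A ω ∂P ≤ (T - s) * √B := by
    rw [hAeq, integral_finsetSum _ fun i _ => hi i]
    simp_rw [integral_mul_const, mul_comm _ (G.t (n + 1) _ - _)]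
    refine (sum_grid_mul_le (G.mono _) (B := √B) (fun i => (integral_abs_le_sqrt
      (hα.memLp i)).trans (Real.sqrt_le_sqrt (hBb i))) _).trans ?_
    gcongr
    · exact (G.mem_Icc _ _).2
    · exact (G.zero _).ge
  have hA0 : 0 ≤ᵐ[P] A := ae_of_all _ fun ω => by
    rw [hAeq]
    exact Finset.sum_nonneg fun i _ => mul_nonneg (abs_nonneg _) (G.step_nonneg _ i)
  have hAle : P {ω | ε ≤ A ω} ≤ ENNReal.ofReal ((T - s) * √B / ε) := by
    rw [← ofReal_measureReal]
    refine ENNReal.ofReal_le_ofReal ?_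
    rw [le_div_iff₀ hε, mul_comm]
    exact (mul_meas_ge_le_integral_of_nonneg hA0 hAi ε).trans hAint
  refine (measure_mono hsub).trans ((measure_union_le _ _).trans ((add_le_add hAle hBle).trans ?_))
  rw [← ENNReal.ofReal_add (by positivity) (by positivity), add_div]

/-- Almost surely, the interpolated Euler schemes converge uniformly at a geometric rate. -/
lemma ae_eventually_abs_interp_succ_sub_le (hW : IsBrownianOn P F T W) (hs : 0 ≤ s)
    (hb : LipschitzWith K b) (hσ : LipschitzWith K σ) (x : ℝ) :
    ∀ᵐ ω ∂P, ∀ᶠ n in atTop, ∀ t ∈ Icc s T,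
      |G.interp W b σ x (n + 1) t ω - G.interp W b σ x n t ω| ≤ 2 * √√(1 / 2) ^ n := by
  obtain ⟨C, hC0, hC⟩ := G.exists_integral_euler_succ_sub_sq_le hW hs hb hσ x
  have hD := sub_nonneg.2 G.le
  -- With `r = 2^{-1/4}`, the square roots of the mean-square bounds are of order `2^{-n/2} =
  -- r^{2n}`. Dividing by the threshold `r^n` leaves the summable bound `r^n`.
  set r : ℝ := √√(1 / 2) with hr
  have hr0 : 0 < r := by positivity
  have hr2 : r ^ 2 = √(1 / 2) := Real.sq_sqrt (by positivity)
  have hr4 : (r ^ 2) ^ 2 = 1 / 2 := by rw [hr2]; exact Real.sq_sqrt (by norm_num)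
  have hr1 : r < 1 := by
    by_contra hcon
    have : (1 : ℝ) ≤ (r ^ 2) ^ 2 := one_le_pow₀ (one_le_pow₀ (not_lt.1 hcon))
    rw [hr4] at this
    norm_num at this
  have hB : ∀ {ψ}, LipschitzWith K ψ → ∀ n j,
      ∫ ω, G.coefDiff W b σ x ψ n j ω ^ 2 ∂P ≤ K ^ 2 * (C * (1 / 2) ^ n) := fun hψ n j =>
    (G.integral_coefDiff_sq_le hW hs hb hσ hψ n j).trans
      (mul_le_mul_of_nonneg_left (hC n j) (by positivity))
  have hmeas : ∀ n, P {ω | ∃ k j, j ≤ 2 ^ (n + 2 + k) ∧ 2 * r ^ n ≤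
      |G.interp W b σ x (n + 1) (G.t (n + 1 + k) j) ω - G.interp W b σ x n (G.t (n + 1 + k) j) ω|}
      ≤ ENNReal.ofReal (((T - s) * √(K ^ 2 * C) + √((T - s) * (K ^ 2 * C))) * r ^ n) := by
    intro n
    refine (G.measure_exists_interp_succ_sub_le hW hs hb hσ (pow_pos hr0 n) (hB hb n)
      (hB hσ n)).trans (ENNReal.ofReal_le_ofReal (le_of_eq ?_))
    have e : √((1 / 2 : ℝ) ^ n) = r ^ n * r ^ n := by
      rw [← hr4, ← pow_mul, ← pow_mul, Real.sqrt_eq_iff_mul_self_eq (by positivity) (by positivity)]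
      ring
    have e1 : √((K : ℝ) ^ 2 * (C * (1 / 2) ^ n)) = √(K ^ 2 * C) * (r ^ n * r ^ n) := by
      rw [← mul_assoc, Real.sqrt_mul (by positivity), e]
    have e2 : √((T - s) * ((K : ℝ) ^ 2 * (C * (1 / 2) ^ n)))
        = √((T - s) * (K ^ 2 * C)) * (r ^ n * r ^ n) := by
      rw [← e, ← Real.sqrt_mul (by positivity)]
      congr 1; ring
    rw [e1, e2]
    field_simp
  have hsum : ∑' n, P {ω | ∃ k j, j ≤ 2 ^ (n + 2 + k) ∧ 2 * r ^ n ≤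
      |G.interp W b σ x (n + 1) (G.t (n + 1 + k) j) ω - G.interp W b σ x n (G.t (n + 1 + k) j) ω|}
      ≠ ∞ := by
    refine ne_top_of_le_ne_top ?_ (ENNReal.tsum_le_tsum hmeas)
    rw [← ENNReal.ofReal_tsum_of_nonneg (fun n => by positivity)
      ((summable_geometric_of_lt_one hr0.le hr1).mul_left _)]
    exact ENNReal.ofReal_ne_top
  -- Borel–Cantelli. The bound obtained at all points of all finer grids extends to every `t` by
  -- continuity.
  filter_upwards [ae_eventually_notMem hsum, hW.continuous] with ω hω hWω
  filter_upwards [hω] with n hn t ht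
  simp only [not_exists, not_and, not_le] at hn
  have hcont : ContinuousWithinAt (fun t => |G.interp W b σ x (n + 1) t ω
      - G.interp W b σ x n t ω|) (Icc s T) t := ((G.continuousOn_interp (x := x) (b := b) (σ := σ) hs (n + 1) hWω).sub
      (G.continuousOn_interp hs n hWω)).abs t ht
  have hlim : Tendsto (fun k => G.t (n + 1 + k) (G.idx (n + 1 + k) t)) atTop (𝓝[Icc s T] t) :=
    tendsto_nhdsWithin_iff.2 ⟨(G.tendsto_t_idx ht).comp
      (tendsto_atTop_mono (fun k => Nat.le_add_left _ _) tendsto_id),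
      Eventually.of_forall fun k => G.mem_Icc _ _⟩
  refine le_of_tendsto (hcont.tendsto.comp hlim) (Eventually.of_forall fun k => ?_)
  exact (hn k _ ((G.idx_le _ t).trans_eq (by ring))).le

/-- Almost surely, the Euler schemes converge to a continuous limit. -/
lemma ae_exists_tendsto_euler (hW : IsBrownianOn P F T W) (hs : 0 ≤ s)
    (hb : LipschitzWith K b) (hσ : LipschitzWith K σ) (x : ℝ) :
    ∀ᵐ ω ∂P, ∃ l : ℝ → ℝ, ContinuousOn l (Icc s T) ∧ ∀ t ∈ Icc s T,
      Tendsto (fun n => G.euler W b σ x n (G.idx n t) ω) atTop (𝓝 (l t)) := by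
  have hr1 : √√(1 / 2 : ℝ) < 1 := by
    rw [Real.sqrt_lt' one_pos, Real.sqrt_lt' (by norm_num)]; norm_num
  filter_upwards [G.ae_eventually_abs_interp_succ_sub_le hW hs hb hσ x, hW.continuous]
    with ω hω hWω
  obtain ⟨l, hl, hunif⟩ := exists_tendstoUniformlyOn_of_geometric hr1 (Real.sqrt_nonneg _)
    (fun n => G.continuousOn_interp hs n hWω) hω
  refine ⟨l, hl, fun t ht => ?_⟩
  -- The Euler value is the interpolation at a grid point that tends to `t`. Uniform convergence and
  -- continuity of `l` combine to give the limit `l t`.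
  have hlim : Tendsto (fun n => G.t n (G.idx n t)) atTop (𝓝[Icc s T] t) :=
    tendsto_nhdsWithin_iff.2 ⟨G.tendsto_t_idx ht, Eventually.of_forall fun k => G.mem_Icc _ _⟩
  have h1 : Tendsto (fun n => l (G.t n (G.idx n t))) atTop (𝓝 (l t)) := (hl t ht).tendsto.comp hlim
  rw [Metric.tendsto_atTop] at h1 ⊢
  intro ε hε
  obtain ⟨N₁, hN₁⟩ := h1 (ε / 2) (half_pos hε)
  obtain ⟨N₂, hN₂⟩ := eventually_atTop.1
    (Metric.tendstoUniformlyOn_iff.1 hunif (ε / 2) (half_pos hε))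
  refine ⟨max N₁ N₂, fun n hn => ?_⟩
  have h2 := hN₁ n (le_of_max_le_left hn)
  have h3 := hN₂ n (le_of_max_le_right hn) _ (G.mem_Icc n (G.idx n t))
  rw [G.interp_grid (G.idx_le n t), dist_comm] at h3
  linarith [dist_triangle (G.euler W b σ x n (G.idx n t) ω) (l (G.t n (G.idx n t))) (l t)]

end StepGrid

end

/-! ### The limit process: measurability and `L²` rate -/

section

variable {Ω : Type*} [mΩ : MeasurableSpace Ω]

lemma lintegral_enorm_sq_eq {μ : Measure Ω} {f : Ω → ℝ} (hf : MemLp f 2 μ) :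
    ∫⁻ ω, ‖f ω‖ₑ ^ 2 ∂μ = ENNReal.ofReal (∫ ω, f ω ^ 2 ∂μ) := by
  rw [ofReal_integral_eq_lintegral_ofReal hf.integrable_sq (ae_of_all _ fun ω => sq_nonneg _)]
  refine lintegral_congr fun ω => ?_
  rw [Real.enorm_eq_ofReal_abs, ← ENNReal.ofReal_pow (abs_nonneg _), sq_abs]

lemma eLpNorm_two_eq_ofReal_sqrt {μ : Measure Ω} {f : Ω → ℝ} (hf : MemLp f 2 μ) :
    eLpNorm f 2 μ = ENNReal.ofReal √(∫ ω, f ω ^ 2 ∂μ) := by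
  rw [eLpNorm_two_eq_lintegral_rpow, lintegral_enorm_sq_eq hf, Real.sqrt_eq_rpow,
    ENNReal.ofReal_rpow_of_nonneg (integral_nonneg fun ω => sq_nonneg _) (by norm_num)]

lemma lintegral_enorm_sq_eq_eLpNorm_sq {μ : Measure Ω} (f : Ω → ℝ) :
    ∫⁻ ω, ‖f ω‖ₑ ^ 2 ∂μ = eLpNorm f 2 μ ^ 2 := by
  rw [eLpNorm_two_eq_lintegral_rpow, ← ENNReal.rpow_natCast, ← ENNReal.rpow_mul]
  norm_num

/-- If the increments of a sequence decay geometrically in `L²`, so do the distances to its almost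
sure limit. -/
lemma eLpNorm_sub_lim_le_of_geometric {μ : Measure Ω} {f : ℕ → Ω → ℝ} {g : Ω → ℝ} {C r : ℝ}
    (hC : 0 ≤ C) (hr0 : 0 ≤ r) (hr1 : r < 1) (hf : ∀ n, AEStronglyMeasurable (f n) μ)
    (hinc : ∀ n, eLpNorm (f (n + 1) - f n) 2 μ ≤ ENNReal.ofReal (C * r ^ n))
    (hlim : ∀ᵐ ω ∂μ, Tendsto (fun n => f n ω) atTop (𝓝 (g ω))) (n : ℕ) :
    eLpNorm (fun ω => g ω - f n ω) 2 μ ≤ ENNReal.ofReal (C / (1 - r) * r ^ n) := by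
  have h1r : 0 < 1 - r := sub_pos.2 hr1
  have hk : ∀ k, eLpNorm (f (n + k) - f n) 2 μ
      ≤ ENNReal.ofReal (C / (1 - r) * (r ^ n - r ^ (n + k))) := by
    intro k
    induction k with
    | zero => simp
    | succ k ih =>
      have e : f (n + (k + 1)) - f n = (f (n + k + 1) - f (n + k)) + (f (n + k) - f n) := by
        rw [← add_assoc]; abel
      have hle : r ^ (n + k) ≤ r ^ n := pow_le_pow_of_le_one hr0 hr1.le (Nat.le_add_right _ _)
      rw [e]
      refine (eLpNorm_add_le ((hf _).sub (hf _)) ((hf _).sub (hf _)) (by norm_num)).trans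
        ((add_le_add (hinc _) ih).trans (le_of_eq ?_))
      rw [← ENNReal.ofReal_add (by positivity) (mul_nonneg (by positivity) (sub_nonneg.2 hle))]
      congr 1
      field_simp
      ring
  -- Fatou in `k` with `n` fixed transfers the telescoped geometric bound to the limit.
  have hfatou := Lp.eLpNorm_lim_le_liminf_eLpNorm (p := 2) (f := fun k => f (n + k) - f n)
    (fun k => (hf _).sub (hf _)) (fun ω => g ω - f n ω) (hlim.mono fun ω hω => by
      refine Tendsto.sub_const ?_ _
      exact hω.comp (tendsto_atTop_mono (fun k => Nat.le_add_left _ _) tendsto_id))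
  refine hfatou.trans ((liminf_le_liminf (Eventually.of_forall fun k => (hk k).trans
    (ENNReal.ofReal_le_ofReal ?_))).trans (liminf_const _).le)
  exact mul_le_mul_of_nonneg_left (sub_le_self _ (pow_nonneg hr0 _)) (by positivity)

namespace StepGrid

/-- The limit of the Euler schemes. -/
def limit {s T : ℝ} {u : ℝ → ℝ} (G : StepGrid s T u) {Ω : Type*} (W : ℝ → Ω → ℝ)
    (b σ : ℝ × ℝ → ℝ) (x t : ℝ) (ω : Ω) : ℝ :=
  limsup (fun n => G.euler W b σ x n (G.idx n t) ω) atTop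

variable {P : Measure Ω} [IsProbabilityMeasure P] {F : Filtration ℝ mΩ} {T : ℝ} {W : ℝ → Ω → ℝ}
  {s : ℝ} {u : ℝ → ℝ} (G : StepGrid s T u) {b σ : ℝ × ℝ → ℝ} {K : NNReal} {x : ℝ}

lemma measurable_euler_idx (hW : IsBrownianOn P F T W) (hs : 0 ≤ s) (hb : LipschitzWith K b)
    (hσ : LipschitzWith K σ) (n : ℕ) :
    Measurable (fun p : ℝ × Ω => G.euler W b σ x n (G.idx n p.1) p.2) := by
  have hm : Measurable (fun p : ℕ × Ω => G.euler W b σ x n p.1 p.2) :=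
    measurable_from_prod_countable_right fun j =>
      ((G.gridAdapted_euler hW hs hb hσ n).meas j).mono (F.le _) le_rfl
  exact hm.comp (((G.measurable_idx n).comp measurable_fst).prodMk measurable_snd)

lemma measurable_limit (hW : IsBrownianOn P F T W) (hs : 0 ≤ s) (hb : LipschitzWith K b)
    (hσ : LipschitzWith K σ) : Measurable (fun p : ℝ × Ω => G.limit W b σ x p.1 p.2) :=
  Measurable.limsup fun n => G.measurable_euler_idx hW hs hb hσ n

lemma measurable_filtration_euler_idx (hW : IsBrownianOn P F T W) (hs : 0 ≤ s)
    (hb : LipschitzWith K b) (hσ : LipschitzWith K σ) (n : ℕ) {t : ℝ} (ht : s ≤ t) :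
    Measurable[F t] (G.euler W b σ x n (G.idx n t)) :=
  ((G.gridAdapted_euler hW hs hb hσ n).meas _).mono (F.mono (G.t_idx_le n ht)) le_rfl

/-- Since `limit` is a limsup taken on every path, no null set is discarded and the filtration need
not be complete. -/
lemma measurable_filtration_limit (hW : IsBrownianOn P F T W) (hs : 0 ≤ s)
    (hb : LipschitzWith K b) (hσ : LipschitzWith K σ) {t : ℝ} (ht : s ≤ t) :
    Measurable[F t] (G.limit W b σ x t) :=
  Measurable.limsup fun n => G.measurable_filtration_euler_idx hW hs hb hσ n ht

lemma isMeasurableAdapted_limit (hW : IsBrownianOn P F T W) (hs : 0 ≤ s)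
    (hb : LipschitzWith K b) (hσ : LipschitzWith K σ) :
    IsMeasurableAdapted F s T (G.limit W b σ x) := by
  have hf : Measurable (fun p : Icc s T × Ω => ((p.1 : ℝ), p.2)) := by fun_prop
  have h1 := (G.measurable_limit (x := x) hW hs hb hσ).comp hf
  have h2 := fun t (ht : t ∈ Icc s T) =>
    G.measurable_filtration_limit (x := x) hW hs hb hσ ht.1
  exact ⟨h1, h2⟩

lemma ae_continuousOn_limit (hW : IsBrownianOn P F T W) (hs : 0 ≤ s)
    (hb : LipschitzWith K b) (hσ : LipschitzWith K σ) (x : ℝ) :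
    ∀ᵐ ω ∂P, ContinuousOn (fun t => G.limit W b σ x t ω) (Icc s T) ∧ ∀ t ∈ Icc s T,
      Tendsto (fun n => G.euler W b σ x n (G.idx n t) ω) atTop (𝓝 (G.limit W b σ x t ω)) := by
  filter_upwards [G.ae_exists_tendsto_euler hW hs hb hσ x] with ω ⟨l, hl, h⟩
  have e : ∀ t ∈ Icc s T, G.limit W b σ x t ω = l t := fun t ht => (h t ht).limsup_eq
  exact ⟨hl.congr e, fun t ht => (e t ht).symm ▸ h t ht⟩

/-- The Euler schemes converge in `L²`, uniformly in time. -/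
lemma exists_eLpNorm_limit_sub_le (hW : IsBrownianOn P F T W) (hs : 0 ≤ s)
    (hb : LipschitzWith K b) (hσ : LipschitzWith K σ) (x : ℝ) :
    ∃ C, 0 ≤ C ∧ ∀ n, ∀ t ∈ Icc s T,
      eLpNorm (fun ω => G.limit W b σ x t ω - G.euler W b σ x n (G.idx n t) ω) 2 P
        ≤ ENNReal.ofReal (C * √(1 / 2) ^ n) := by
  obtain ⟨C, hC0, hC⟩ := G.exists_integral_euler_succ_sub_sq_le hW hs hb hσ x
  have hr1 : √(1 / 2 : ℝ) < 1 := by rw [Real.sqrt_lt' one_pos]; norm_num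
  have h1r : 0 < 1 - √(1 / 2 : ℝ) := sub_pos.2 hr1
  refine ⟨√C / (1 - √(1 / 2)), by positivity, fun n t ht => ?_⟩
  have hE := fun n => G.gridAdapted_euler (x := x) hW hs hb hσ n
  have hpow : ∀ n : ℕ, √(1 / 2 : ℝ) ^ n = √((1 / 2) ^ n) := fun n => by
    rw [eq_comm, Real.sqrt_eq_iff_mul_self_eq (by positivity) (by positivity), ← mul_pow,
      Real.mul_self_sqrt (by norm_num)]
  refine eLpNorm_sub_lim_le_of_geometric (Real.sqrt_nonneg C) (Real.sqrt_nonneg _) hr1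
    (f := fun n => G.euler W b σ x n (G.idx n t))
    (fun n => ((hE n).memLp _).aestronglyMeasurable) (fun n => ?_)
    ((G.ae_continuousOn_limit hW hs hb hσ x).mono fun ω hω => hω.2 t ht) n
  rw [eLpNorm_two_eq_ofReal_sqrt (((hE (n + 1)).memLp _).sub ((hE n).memLp _)),
    hpow, ← Real.sqrt_mul hC0]
  refine ENNReal.ofReal_le_ofReal (Real.sqrt_le_sqrt ?_)
  rw [← G.idx_succ_div_two n ht.1]
  exact hC n _

/-- The limit stays within a bounded `L²` distance of the coarsest scheme, whose moments are
bounded. -/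
lemma exists_lintegral_limit_sq_le (hW : IsBrownianOn P F T W) (hs : 0 ≤ s)
    (hb : LipschitzWith K b) (hσ : LipschitzWith K σ) (x : ℝ) :
    ∃ C : ℝ≥0∞, C ≠ ∞ ∧ ∀ t ∈ Icc s T, ∫⁻ ω, ‖G.limit W b σ x t ω‖ₑ ^ 2 ∂P ≤ C := by
  obtain ⟨C, -, hC⟩ := G.exists_eLpNorm_limit_sub_le hW hs hb hσ x
  obtain ⟨C₀, -, hC₀⟩ := G.exists_integral_euler_sq_le hW hs hb hσ x
  refine ⟨(ENNReal.ofReal (C * √(1 / 2) ^ 0) + ENNReal.ofReal √C₀) ^ 2, by finiteness,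
    fun t ht => ?_⟩
  rw [lintegral_enorm_sq_eq_eLpNorm_sq]
  gcongr
  have hE := (G.gridAdapted_euler (x := x) hW hs hb hσ 0).memLp (G.idx 0 t)
  have hX : Measurable (G.limit W b σ x t) :=
    (G.measurable_filtration_limit hW hs hb hσ ht.1).mono (F.le t) le_rfl
  have e : G.limit W b σ x t = (fun ω => G.limit W b σ x t ω - G.euler W b σ x 0 (G.idx 0 t) ω)
      + G.euler W b σ x 0 (G.idx 0 t) := by ext; simp
  rw [e]
  refine (eLpNorm_add_le (hX.aestronglyMeasurable.sub hE.aestronglyMeasurable)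
    hE.aestronglyMeasurable (by norm_num)).trans (add_le_add (hC 0 t ht) ?_)
  rw [eLpNorm_two_eq_ofReal_sqrt hE]
  exact ENNReal.ofReal_le_ofReal (Real.sqrt_le_sqrt (hC₀ 0 _))

end StepGrid

end

/-! ### Approximation of the coefficients in `L²([s, t] × Ω)` -/

section

variable {Ω : Type*} [mΩ : MeasurableSpace Ω]

lemma enorm_add_sq_le (x y : ℝ) : ‖x + y‖ₑ ^ 2 ≤ 2 * ‖x‖ₑ ^ 2 + 2 * ‖y‖ₑ ^ 2 := by
  have h : ∀ z : ℝ, ‖z‖ₑ ^ 2 = ENNReal.ofReal (z ^ 2) := fun z => by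
    rw [Real.enorm_eq_ofReal_abs, ← ENNReal.ofReal_pow (abs_nonneg _), sq_abs]
  have h2 : (2 : ℝ≥0∞) = ENNReal.ofReal 2 := by simp
  rw [h, h, h, h2, ← ENNReal.ofReal_mul (by norm_num), ← ENNReal.ofReal_mul (by norm_num),
    ← ENNReal.ofReal_add (by positivity) (by positivity)]
  exact ENNReal.ofReal_le_ofReal (by nlinarith [sq_nonneg (x - y)])

lemma enorm_sq_le_of_sq_le {x y c : ℝ} (hc : 0 ≤ c) (h : x ^ 2 ≤ c * y ^ 2) :
    ‖x‖ₑ ^ 2 ≤ ENNReal.ofReal c * ‖y‖ₑ ^ 2 := by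
  rw [Real.enorm_eq_ofReal_abs, Real.enorm_eq_ofReal_abs, ← ENNReal.ofReal_pow (abs_nonneg _),
    ← ENNReal.ofReal_pow (abs_nonneg _), sq_abs, sq_abs, ← ENNReal.ofReal_mul hc]
  exact ENNReal.ofReal_le_ofReal h

/-- Cauchy–Schwarz against the constant `1`, in extended reals so that no integrability of `g` is
asked. -/
lemma enorm_intervalIntegral_sq_le {g : ℝ → ℝ} {s t : ℝ} (hst : s ≤ t) (hg : Measurable g) :
    ‖∫ r in s..t, g r‖ₑ ^ 2 ≤ ENNReal.ofReal (t - s) * ∫⁻ r in Icc s t, ‖g r‖ₑ ^ 2 := by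
  rw [intervalIntegral.integral_of_le hst, ← integral_Icc_eq_integral_Ioc]
  have h1 : ‖∫ r in Icc s t, g r‖ₑ ≤ eLpNorm g 2 (volume.restrict (Icc s t))
      * (ENNReal.ofReal (t - s)) ^ (1 / 2 : ℝ) := by
    refine (enorm_integral_le_lintegral_enorm _).trans ?_
    rw [← eLpNorm_one_eq_lintegral_enorm]
    refine (eLpNorm_le_eLpNorm_mul_rpow_measure_univ (p := 1) (q := 2) (by norm_num)
      hg.aestronglyMeasurable).trans (le_of_eq ?_)
    rw [Measure.restrict_apply_univ, Real.volume_Icc]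
    norm_num
  refine (pow_le_pow_left₀ zero_le h1 2).trans (le_of_eq ?_)
  rw [mul_pow, ← lintegral_enorm_sq_eq_eLpNorm_sq, ← ENNReal.rpow_natCast (_ ^ _),
    ← ENNReal.rpow_mul, mul_comm]
  norm_num

/-- Square integrable coefficients along a grid are approximated by bounded ones. -/
lemma GridAdapted.exists_bounded_approx {P : Measure Ω} {F : Filtration ℝ mΩ} {τ : ℕ → ℝ}
    {β : ℕ → Ω → ℝ} [IsFiniteMeasure P] (hβ : GridAdapted P F τ β) (J : ℕ) {ε : ℝ} (hε : 0 < ε) :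
    ∃ ξ : ℕ → Ω → ℝ, GridAdapted P F τ ξ ∧ (∃ C : ℝ, ∀ i ω, |ξ i ω| ≤ C) ∧
      ∑ i ∈ Finset.range J, (τ (i + 1) - τ i) * ∫ ω, (β i ω - ξ i ω) ^ 2 ∂P ≤ ε := by
  -- Truncation at level `R`. At each `ω` it is eventually inactive, and `β²` dominates the squared
  -- error.
  set ξ : ℕ → ℕ → Ω → ℝ := fun R i ω => max (-(R : ℝ)) (min (β i ω) R) with hξ
  have hbd : ∀ R i ω, |ξ R i ω| ≤ R := fun R i ω => by
    have : (0 : ℝ) ≤ R := Nat.cast_nonneg R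
    exact abs_le.2 ⟨le_max_left _ _, max_le (by linarith) (min_le_right _ _)⟩
  have hm : ∀ R i, Measurable[F (τ i)] (ξ R i) := fun R i =>
    measurable_const.max ((hβ.meas i).min measurable_const)
  have hadp : ∀ R, GridAdapted P F τ (ξ R) := fun R => ⟨hm R, fun i =>
    MemLp.of_bound ((hm R i).mono (F.le _) le_rfl).aestronglyMeasurable R
      (ae_of_all _ fun ω => hbd R i ω)⟩
  have hle : ∀ R i ω, ‖(β i ω - ξ R i ω) ^ 2‖ ≤ β i ω ^ 2 := fun R i ω => by
    have hR : (0 : ℝ) ≤ R := Nat.cast_nonneg R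
    rw [Real.norm_eq_abs, abs_of_nonneg (sq_nonneg _)]
    refine sq_le_sq.2 ?_
    simp only [hξ]
    rcases le_total (β i ω) R with h1 | h1
    · rw [min_eq_left h1]
      rcases le_total (-(R : ℝ)) (β i ω) with h2 | h2
      · simp [max_eq_right h2]
      · rw [max_eq_left h2, abs_of_nonpos (by linarith), abs_of_nonpos (by linarith)]
        linarith
    · rw [min_eq_right h1, max_eq_right (by linarith), abs_of_nonneg (by linarith),
        abs_of_nonneg (by linarith)]
      linarith
  have hlim : ∀ i, Tendsto (fun R => ∫ ω, (β i ω - ξ R i ω) ^ 2 ∂P) atTop (𝓝 0) := by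
    intro i
    have := tendsto_integral_of_dominated_convergence (μ := P) (f := fun _ => (0 : ℝ))
      (F := fun R ω => (β i ω - ξ R i ω) ^ 2) (fun ω => β i ω ^ 2)
      (fun R => ((((hβ.memLp i).sub ((hadp R).memLp i)).aestronglyMeasurable).pow 2))
      (hβ.memLp i).integrable_sq (fun R => ae_of_all _ (hle R i)) (ae_of_all _ fun ω => ?_)
    · simpa using this
    · refine tendsto_const_nhds.congr' ?_
      filter_upwards [eventually_ge_atTop ⌈|β i ω|⌉₊] with R hR
      have h1 : |β i ω| ≤ R := (Nat.le_ceil _).trans (by exact_mod_cast hR)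
      obtain ⟨h2, h3⟩ := abs_le.1 h1
      simp [hξ, min_eq_left h3, max_eq_right h2]
  have hsum : Tendsto (fun R => ∑ i ∈ Finset.range J, (τ (i + 1) - τ i) *
      ∫ ω, (β i ω - ξ R i ω) ^ 2 ∂P) atTop (𝓝 0) := by
    simpa using tendsto_finsetSum (Finset.range J) fun i _ =>
      (hlim i).const_mul (τ (i + 1) - τ i)
  obtain ⟨R, hR⟩ := (hsum.eventually (gt_mem_nhds hε)).exists
  exact ⟨ξ R, hadp R, ⟨R, hbd R⟩, hR.le⟩

/-- The integral of a step function along a grid. -/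
lemma integral_step_function {τ : ℕ → ℝ} (hτ : Monotone τ) {f : ℝ → ℝ} {c : ℕ → ℝ} {J : ℕ} {t : ℝ}
    (hJ : τ J ≤ t) (h : ∀ i < J, ∀ r ∈ Ioo (τ i) (τ (i + 1)), f r = c i)
    (h0 : ∀ r, τ J < r → f r = 0) :
    IntervalIntegrable f volume (τ 0) t ∧
      ∫ r in τ 0..t, f r = ∑ i ∈ Finset.range J, (τ (i + 1) - τ i) * c i := by
  have hcell : ∀ i < J, ∀ᵐ r, r ∈ uIoc (τ i) (τ (i + 1)) → f r = c i := fun i hi => by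
    have hne : ∀ᵐ r : ℝ, r ≠ τ (i + 1) := by simp [ae_iff]
    filter_upwards [hne] with r hr hri
    rw [uIoc_of_le (hτ i.le_succ)] at hri
    exact h i hi r ⟨hri.1, lt_of_le_of_ne hri.2 hr⟩
  have hint : ∀ i < J, IntervalIntegrable f volume (τ i) (τ (i + 1)) := fun i hi =>
    (intervalIntegrable_const (c := c i)).congr_ae
      ((ae_restrict_iff' measurableSet_uIoc).2 ((hcell i hi).mono fun r hr hri => (hr hri).symm))
  have htail : ∀ᵐ r, r ∈ uIoc (τ J) t → f r = 0 := ae_of_all _ fun r hr => by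
    rw [uIoc_of_le hJ] at hr
    exact h0 r hr.1
  have htaili : IntervalIntegrable f volume (τ J) t :=
    (intervalIntegrable_const (c := (0 : ℝ))).congr_ae
      ((ae_restrict_iff' measurableSet_uIoc).2 (htail.mono fun r hr hri => (hr hri).symm))
  have hall := IntervalIntegrable.trans_iterate hint
  refine ⟨hall.trans htaili, ?_⟩
  rw [← intervalIntegral.integral_add_adjacent_intervals hall htaili,
    ← intervalIntegral.sum_integral_adjacent_intervals hint,
    intervalIntegral.integral_congr_ae htail, intervalIntegral.integral_zero, add_zero]
  refine Finset.sum_congr rfl fun i hi => ?_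
  rw [intervalIntegral.integral_congr_ae (hcell i (Finset.mem_range.1 hi)),
    intervalIntegral.integral_const, smul_eq_mul]

namespace StepGrid

section Approx

variable {s T : ℝ} {u : ℝ → ℝ} (G : StepGrid s T u) {Ω : Type*} (W : ℝ → Ω → ℝ)
  (b σ : ℝ × ℝ → ℝ) (x : ℝ)

/-- A coefficient along the `n`-th Euler scheme, cut off after the last grid point before `t`. -/
def approx (ψ : ℝ × ℝ → ℝ) (n : ℕ) (t r : ℝ) (ω : Ω) : ℝ :=
  if r ≤ G.t n (G.idx n t) then ψ (G.euler W b σ x n (G.idx n r) ω, u r) else 0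

variable {W b σ x}

/-- `idx` is constant on cells closed on the left and `u` on cells closed on the right, so the two
agree on open cells only. The missing endpoints are null. -/
lemma approx_cell {ψ : ℝ × ℝ → ℝ} {n i : ℕ} {t r : ℝ} (hi : i < G.idx n t)
    (hr : r ∈ Ioo (G.t n i) (G.t n (i + 1))) (ω : Ω) :
    G.approx W b σ x ψ n t r ω = G.coef W b σ x ψ n i ω := by
  rw [approx, if_pos (hr.2.le.trans (G.mono n hi)), G.idx_eq (hi.trans_le (G.idx_le n t))
    ⟨hr.1.le, hr.2⟩, G.v_eq n i r ⟨hr.1, hr.2.le⟩, coef]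

lemma approx_tail {ψ : ℝ × ℝ → ℝ} {n : ℕ} {t r : ℝ} (hr : G.t n (G.idx n t) < r) (ω : Ω) :
    G.approx W b σ x ψ n t r ω = 0 := if_neg (not_le.2 hr)

/-- The cutoff makes the time integral coincide exactly with the drift part of the scheme at the
last grid point before `t`. -/
lemma integral_approx {ψ : ℝ × ℝ → ℝ} (n : ℕ) {t : ℝ} (ht : s ≤ t) (ω : Ω) :
    IntervalIntegrable (fun r => G.approx W b σ x ψ n t r ω) volume s t ∧
      ∫ r in s..t, G.approx W b σ x ψ n t r ω
        = gridSum W (G.t n) (G.coef W b σ x ψ n) 0 (G.idx n t) ω := by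
  have := integral_step_function (G.mono n) (G.t_idx_le n ht)
    (fun i hi r hr => G.approx_cell (W := W) (b := b) (σ := σ) (x := x) (ψ := ψ) hi hr ω)
    (fun r hr => G.approx_tail hr ω)
  rw [G.zero] at this
  refine ⟨this.1, this.2.trans ?_⟩
  simp [gridSum, mul_comm]

end Approx

variable {P : Measure Ω} [IsProbabilityMeasure P] {F : Filtration ℝ mΩ} {T : ℝ} {W : ℝ → Ω → ℝ}
  {s : ℝ} {u : ℝ → ℝ} (G : StepGrid s T u) {b σ : ℝ × ℝ → ℝ} {K : NNReal} {x : ℝ}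

lemma measurable_approx (hW : IsBrownianOn P F T W) (hs : 0 ≤ s) (hb : LipschitzWith K b)
    (hσ : LipschitzWith K σ) {ψ : ℝ × ℝ → ℝ} (hψ : LipschitzWith K ψ) (n : ℕ) (t : ℝ) :
    Measurable (fun p : ℝ × Ω => G.approx W b σ x ψ n t p.1 p.2) := by
  unfold approx
  have h1 := G.measurable_euler_idx (x := x) hW hs hb hσ n
  have h2 : Measurable (fun p : ℝ × Ω => u p.1) := G.measurable.comp measurable_fst
  exact Measurable.ite (measurableSet_le measurable_fst measurable_const)
    (hψ.continuous.measurable.comp (h1.prodMk h2)) measurable_const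

lemma measurable_comp_limit (hW : IsBrownianOn P F T W) (hs : 0 ≤ s) (hb : LipschitzWith K b)
    (hσ : LipschitzWith K σ) {ψ : ℝ × ℝ → ℝ} (hψ : LipschitzWith K ψ) :
    Measurable (fun p : ℝ × Ω => ψ (G.limit W b σ x p.1 p.2, u p.1)) := by
  have h1 := G.measurable_limit (x := x) hW hs hb hσ
  have h2 : Measurable (fun p : ℝ × Ω => u p.1) := G.measurable.comp measurable_fst
  exact hψ.continuous.measurable.comp (h1.prodMk h2)

/-- The coefficients along the Euler schemes converge in `L²([s, t] × Ω)`. -/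
lemma tendsto_lintegral_limit_sub_approx (hW : IsBrownianOn P F T W) (hs : 0 ≤ s)
    (hb : LipschitzWith K b) (hσ : LipschitzWith K σ) {ψ : ℝ × ℝ → ℝ} (hψ : LipschitzWith K ψ)
    {t : ℝ} (ht : t ∈ Icc s T) :
    Tendsto (fun n => ∫⁻ ω, (∫⁻ r in Icc s t, ‖ψ (G.limit W b σ x r ω, u r)
      - G.approx W b σ x ψ n t r ω‖ₑ ^ 2) ∂P) atTop (𝓝 0) := by
  have hmeas : ∀ n, Measurable (fun p : ℝ × Ω => ‖ψ (G.limit W b σ x p.1 p.2, u p.1)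
      - G.approx W b σ x ψ n t p.1 p.2‖ₑ ^ 2) := fun n =>
    (((G.measurable_comp_limit hW hs hb hσ hψ).sub
      (G.measurable_approx hW hs hb hσ hψ n t)).enorm).pow_const 2
  have hswap : ∀ n, ∫⁻ ω, (∫⁻ r in Icc s t, ‖ψ (G.limit W b σ x r ω, u r)
      - G.approx W b σ x ψ n t r ω‖ₑ ^ 2) ∂P
      = ∫⁻ r in Icc s t, ∫⁻ ω, ‖ψ (G.limit W b σ x r ω, u r)
      - G.approx W b σ x ψ n t r ω‖ₑ ^ 2 ∂P := fun n =>
    (lintegral_lintegral_swap (hmeas n).aemeasurable).symm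
  simp_rw [hswap]
  obtain ⟨C, hC0, hC⟩ := G.exists_eLpNorm_limit_sub_le hW hs hb hσ x
  obtain ⟨M, hM, hXM⟩ := G.exists_lintegral_limit_sq_le hW hs hb hσ x
  obtain ⟨L, hL0, hL⟩ := exists_sq_le_of_lipschitzWith hψ G.bound
  have hr1 : √(1 / 2 : ℝ) < 1 := by rw [Real.sqrt_lt' one_pos]; norm_num
  have hhead : ∀ n, ∀ r ∈ Icc s T, r ≤ G.t n (G.idx n t) →
      ∫⁻ ω, ‖ψ (G.limit W b σ x r ω, u r) - G.approx W b σ x ψ n t r ω‖ₑ ^ 2 ∂P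
        ≤ ENNReal.ofReal (K ^ 2) * ENNReal.ofReal (C * √(1 / 2) ^ n) ^ 2 := by
    intro n r hr hrt
    refine le_trans ?_ (mul_le_mul_right (pow_le_pow_left₀ zero_le (hC n r hr) 2) _)
    rw [← lintegral_enorm_sq_eq_eLpNorm_sq, ← lintegral_const_mul' _ _ ENNReal.ofReal_ne_top]
    refine lintegral_mono fun ω => ?_
    rw [approx, if_pos hrt]
    exact enorm_sq_le_of_sq_le (sq_nonneg _) (sq_sub_le_of_lipschitzWith hψ _ _ _)
  have htail : ∀ n, ∀ r ∈ Icc s T, G.t n (G.idx n t) < r →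
      ∫⁻ ω, ‖ψ (G.limit W b σ x r ω, u r) - G.approx W b σ x ψ n t r ω‖ₑ ^ 2 ∂P
        ≤ ENNReal.ofReal L * (1 + M) := by
    intro n r hr hrt
    have h1 : ∫⁻ ω, (1 + ‖G.limit W b σ x r ω‖ₑ ^ 2) ∂P ≤ 1 + M := by
      rw [lintegral_add_left measurable_const]
      simpa using hXM r hr
    refine le_trans ?_ (mul_le_mul_right h1 _)
    rw [← lintegral_const_mul' _ _ ENNReal.ofReal_ne_top]
    refine lintegral_mono fun ω => ?_
    rw [G.approx_tail hrt, sub_zero]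
    have e : ∀ z : ℝ, ‖z‖ₑ ^ 2 = ENNReal.ofReal (z ^ 2) := fun z => by
      rw [Real.enorm_eq_ofReal_abs, ← ENNReal.ofReal_pow (abs_nonneg _), sq_abs]
    rw [e, e, ← ENNReal.ofReal_one, ← ENNReal.ofReal_add (by positivity) (by positivity),
      ← ENNReal.ofReal_mul hL0]
    exact ENNReal.ofReal_le_ofReal (hL _ _ (G.abs_le r))
  have hsub : Icc s t ⊆ Icc s T := Icc_subset_Icc le_rfl ht.2
  have hκ : Tendsto (fun n : ℕ => ENNReal.ofReal (K ^ 2) * ENNReal.ofReal (C * √(1 / 2) ^ n) ^ 2)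
      atTop (𝓝 0) := by
    have h1 : Tendsto (fun n : ℕ => C * √(1 / 2) ^ n) atTop (𝓝 0) := by
      simpa using (tendsto_pow_atTop_nhds_zero_of_lt_one (Real.sqrt_nonneg _) hr1).const_mul C
    have h2 := ENNReal.Tendsto.const_mul (a := ENNReal.ofReal (K ^ 2))
      ((ENNReal.continuous_pow 2).tendsto _ |>.comp (ENNReal.tendsto_ofReal h1))
      (Or.inr ENNReal.ofReal_ne_top)
    simpa [Function.comp_def] using h2
  have hzero : (0 : ℝ≥0∞) = ∫⁻ _ in Icc s t, 0 := by simp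
  rw [hzero]
  -- Past the last grid point the error is merely bounded, but every fixed `r < t` eventually lies
  -- before it, where the `L²` rate applies. Dominated convergence in `r` concludes.
  refine tendsto_lintegral_of_dominated_convergence
    (fun _ => ENNReal.ofReal (K ^ 2) * ENNReal.ofReal C ^ 2 + ENNReal.ofReal L * (1 + M))
    (fun n => (hmeas n).lintegral_prod_right') (fun n => ?_) ?_ ?_
  · filter_upwards [ae_restrict_mem measurableSet_Icc] with r hr
    rcases le_or_gt r (G.t n (G.idx n t)) with h | h
    · refine (hhead n r (hsub hr) h).trans (le_add_right ?_)
      gcongr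
      exact mul_le_of_le_one_right hC0 (pow_le_one₀ (Real.sqrt_nonneg _) hr1.le)
    · exact (htail n r (hsub hr) h).trans le_add_self
  · rw [lintegral_const, Measure.restrict_apply_univ, Real.volume_Icc]
    finiteness
  · have hne : ∀ᵐ r ∂(volume.restrict (Icc s t)), r ≠ t :=
      ae_restrict_of_ae (by simp [ae_iff])
    filter_upwards [ae_restrict_mem measurableSet_Icc, hne] with r hr hrt
    have hlt : r < t := lt_of_le_of_ne hr.2 hrt
    refine tendsto_of_tendsto_of_tendsto_of_le_of_le' tendsto_const_nhds hκ
      (Eventually.of_forall fun _ => zero_le) ?_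
    filter_upwards [(G.tendsto_t_idx ht).eventually (lt_mem_nhds hlt)] with n hn
    exact hhead n r (hsub hr) hn.le

end StepGrid

end

/-! ### The martingale part of the limit is an Itô integral -/

section

variable {Ω : Type*} [mΩ : MeasurableSpace Ω]

namespace StepGrid

section Elementary

variable {P : Measure Ω} {F : Filtration ℝ mΩ} {s T : ℝ} {u : ℝ → ℝ} (G : StepGrid s T u)

/-- The elementary process on `[s, t]` with bounded coefficients `ξ` along the `n`-th grid. -/
def elementary {n : ℕ} {ξ : ℕ → Ω → ℝ} (hξ : GridAdapted P F (G.t n) ξ)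
    (hbd : ∃ C : ℝ, ∀ i ω, |ξ i ω| ≤ C) {t : ℝ} (ht : s ≤ t) : ElementaryProcess F s t where
  n := G.idx n t
  -- Freezing the index keeps all the times in `[s, t]`, as an elementary process there requires.
  τ i := G.t n (min i (G.idx n t))
  mono := fun _ _ h => G.mono n (min_le_min_right _ h)
  mem := fun _ => ⟨(G.mem_Icc n _).1, (G.mono n (min_le_right _ _)).trans (G.t_idx_le n ht)⟩
  ξ i := ξ (min i (G.idx n t))
  meas := fun _ => hξ.meas _
  bdd := hbd.imp fun _ h _ ω => h _ ω

variable {n : ℕ} {ξ : ℕ → Ω → ℝ} (hξ : GridAdapted P F (G.t n) ξ)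
  (hbd : ∃ C : ℝ, ∀ i ω, |ξ i ω| ≤ C) {t : ℝ} (ht : s ≤ t)

lemma elementary_integral (W : ℝ → Ω → ℝ) (ω : Ω) :
    (G.elementary hξ hbd ht).integral W ω = gridSum W (G.t n) 0 ξ (G.idx n t) ω := by
  simp only [ElementaryProcess.integral, elementary, gridSum, Pi.zero_apply, zero_mul, zero_add]
  refine Finset.sum_congr rfl fun i hi => ?_
  have hi' := Finset.mem_range.1 hi
  rw [min_eq_left hi'.le, min_eq_left (Nat.succ_le_of_lt hi')]

lemma elementary_path_cell {i : ℕ} (hi : i < G.idx n t) {r : ℝ}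
    (hr : r ∈ Ioo (G.t n i) (G.t n (i + 1))) (ω : Ω) :
    (G.elementary hξ hbd ht).path r ω = ξ i ω := by
  simp only [ElementaryProcess.path, elementary]
  rw [Finset.sum_eq_single i]
  · rw [min_eq_left hi.le, min_eq_left (Nat.succ_le_of_lt hi)]
    exact indicator_of_mem (show r ∈ Ioc (G.t n i) (G.t n (i + 1)) from ⟨hr.1, hr.2.le⟩) _
  · intro j _ hji
    refine indicator_of_notMem (fun hj => ?_) _
    rcases lt_or_gt_of_ne hji with h | h
    · exact absurd (hr.1.trans_le hj.2) (not_lt.2 (G.mono n ((min_le_left _ _).trans h)))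
    · exact absurd (hj.1.trans hr.2) (not_lt.2 (G.mono n (le_min h hi)))
  · exact fun h => absurd (Finset.mem_range.2 hi) h

lemma elementary_path_tail {r : ℝ} (hr : G.t n (G.idx n t) < r) (ω : Ω) :
    (G.elementary hξ hbd ht).path r ω = 0 := by
  simp only [ElementaryProcess.path, elementary]
  refine Finset.sum_eq_zero fun j _ => indicator_of_notMem (fun hj => ?_) _
  exact absurd (hr.trans_le hj.2) (not_lt.2 (G.mono n (min_le_right _ _)))

end Elementary

variable {P : Measure Ω} [IsProbabilityMeasure P] {F : Filtration ℝ mΩ} {T : ℝ} {W : ℝ → Ω → ℝ}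
  {s : ℝ} {u : ℝ → ℝ} (G : StepGrid s T u) {b σ : ℝ × ℝ → ℝ} {K : NNReal} {x : ℝ}

attribute [local irreducible] limit approx

omit [IsProbabilityMeasure P] in
/-- The distance in `L²([s, t] × Ω)` of the approximating coefficient to an elementary process. -/
lemma lintegral_approx_sub_elementary {n : ℕ} {ξ : ℕ → Ω → ℝ} (hξ : GridAdapted P F (G.t n) ξ)
    (hbd : ∃ C : ℝ, ∀ i ω, |ξ i ω| ≤ C) {t : ℝ} (ht : s ≤ t) {ψ : ℝ × ℝ → ℝ}
    (hψ : GridAdapted P F (G.t n) (G.coef W b σ x ψ n)) :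
    ∫⁻ ω, (∫⁻ r in Icc s t, ‖G.approx W b σ x ψ n t r ω
      - (G.elementary hξ hbd ht).path r ω‖ₑ ^ 2) ∂P
      = ENNReal.ofReal (∑ i ∈ Finset.range (G.idx n t), (G.t n (i + 1) - G.t n i) *
        ∫ ω, (G.coef W b σ x ψ n i ω - ξ i ω) ^ 2 ∂P) := by
  have hinner : ∀ ω, ∫⁻ r in Icc s t, ‖G.approx W b σ x ψ n t r ω
      - (G.elementary hξ hbd ht).path r ω‖ₑ ^ 2
      = ENNReal.ofReal (∑ i ∈ Finset.range (G.idx n t), (G.t n (i + 1) - G.t n i) *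
        (G.coef W b σ x ψ n i ω - ξ i ω) ^ 2) := by
    intro ω
    have h := integral_step_function (G.mono n) (G.t_idx_le n ht)
      (f := fun r => (G.approx W b σ x ψ n t r ω - (G.elementary hξ hbd ht).path r ω) ^ 2)
      (c := fun i => (G.coef W b σ x ψ n i ω - ξ i ω) ^ 2)
      (fun i hi r hr => by
        simp only [G.approx_cell hi hr, G.elementary_path_cell hξ hbd ht hi hr])
      (fun r hr => by simp [G.approx_tail hr, G.elementary_path_tail hξ hbd ht hr])
    rw [G.zero] at h
    have hint := h.1
    rw [intervalIntegrable_iff_integrableOn_Icc_of_le ht] at hint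
    rw [← h.2, intervalIntegral.integral_of_le ht, ← integral_Icc_eq_integral_Ioc,
      ofReal_integral_eq_lintegral_ofReal hint (ae_of_all _ fun r => sq_nonneg _)]
    refine lintegral_congr fun r => ?_
    rw [Real.enorm_eq_ofReal_abs, ← ENNReal.ofReal_pow (abs_nonneg _), sq_abs]
  have hi : ∀ i, Integrable (fun ω => (G.t n (i + 1) - G.t n i) *
      (G.coef W b σ x ψ n i ω - ξ i ω) ^ 2) P := fun i =>
    ((hψ.memLp i).sub (hξ.memLp i)).integrable_sq.const_mul _
  simp_rw [hinner]
  rw [← ofReal_integral_eq_lintegral_ofReal (integrable_finsetSum _ fun i _ => hi i)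
    (ae_of_all _ fun ω => Finset.sum_nonneg fun i _ =>
      mul_nonneg (G.step_nonneg n i) (sq_nonneg _)), integral_finsetSum _ fun i _ => hi i]
  simp_rw [integral_const_mul]

omit [IsProbabilityMeasure P] in
-- The right side is the same sum as for the distance of the paths, so one choice of truncated
-- coefficients controls both convergences in `IsItoIntegral`.
lemma lintegral_gridSum_sub_sq (hW : IsBrownianOn P F T W) (hs : 0 ≤ s) {n : ℕ}
    {β ξ : ℕ → Ω → ℝ} (hβ : GridAdapted P F (G.t n) β) (hξ : GridAdapted P F (G.t n) ξ) (J : ℕ) :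
    ∫⁻ ω, ‖gridSum W (G.t n) 0 β J ω - gridSum W (G.t n) 0 ξ J ω‖ₑ ^ 2 ∂P
      = ENNReal.ofReal (∑ i ∈ Finset.range J, (G.t n (i + 1) - G.t n i) *
        ∫ ω, (β i ω - ξ i ω) ^ 2 ∂P) := by
  have e : ∀ ω, gridSum W (G.t n) 0 β J ω - gridSum W (G.t n) 0 ξ J ω
      = gridSum W (G.t n) 0 (β - ξ) J ω := fun ω => by
    rw [← gridSum_sub, sub_zero]
  have hsub := hβ.sub hξ
  simp_rw [e]
  rw [lintegral_enorm_sq_eq ((GridAdapted.gridSum hW (G.mono n) (G.mem_Icc_zero hs n)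
    GridAdapted.zero hsub).memLp J), integral_gridSum_sq hW (G.mono n) (G.mem_Icc_zero hs n) hsub]
  rfl

/-- A continuous path is bounded on `[s, T]`, and linear growth bounds the drift along it. -/
lemma ae_intervalIntegrable_comp_limit (hW : IsBrownianOn P F T W) (hs : 0 ≤ s)
    (hb : LipschitzWith K b) (hσ : LipschitzWith K σ) {t : ℝ} (ht : t ∈ Icc s T) :
    ∀ᵐ ω ∂P, IntervalIntegrable (fun r => b (G.limit W b σ x r ω, u r)) volume s t := by
  obtain ⟨L, hL0, hL⟩ := exists_sq_le_of_lipschitzWith hb G.bound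
  filter_upwards [G.ae_continuousOn_limit hW hs hb hσ x] with ω hω
  obtain ⟨M, hM⟩ := isCompact_Icc.exists_bound_of_continuousOn hω.1
  rw [intervalIntegrable_iff_integrableOn_Icc_of_le ht.1]
  have hm : Measurable (fun r => b (G.limit W b σ x r ω, u r)) :=
    (G.measurable_comp_limit hW hs hb hσ hb).comp (measurable_id.prodMk measurable_const)
  refine Integrable.of_bound (μ := volume.restrict (Icc s t)) hm.aestronglyMeasurable
    √(L * (1 + M ^ 2)) ?_
  filter_upwards [ae_restrict_mem measurableSet_Icc] with r hr
  refine Real.abs_le_sqrt ((hL _ _ (G.abs_le r)).trans ?_)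
  have h1 : G.limit W b σ x r ω ^ 2 ≤ M ^ 2 := by
    rw [← sq_abs]
    exact pow_le_pow_left₀ (abs_nonneg _) (hM r ⟨hr.1, hr.2.trans ht.2⟩) 2
  gcongr

/-- The martingale part of the limit of the Euler schemes is an Itô integral. -/
lemma isItoIntegral_limit (hW : IsBrownianOn P F T W) (hs : 0 ≤ s) (hb : LipschitzWith K b)
    (hσ : LipschitzWith K σ) {t : ℝ} (ht : t ∈ Icc s T) :
    IsItoIntegral P F W s t (fun r ω => σ (G.limit W b σ x r ω, u r))
      (fun ω => G.limit W b σ x t ω - x - ∫ r in s..t, b (G.limit W b σ x r ω, u r)) := by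
  have hcoef := fun n => G.gridAdapted_coef (x := x) hW hs hb hσ hσ n
  -- Elementary processes need bounded coefficients, so those of the `n`-th scheme are truncated at
  -- the cost of a squared `L²` error of at most `1 / (n + 1)`.
  have hex := fun n : ℕ => (hcoef n).exists_bounded_approx (G.idx n t)
    (ε := 1 / ((n : ℝ) + 1)) (by positivity)
  choose ξ hξ hbd hξe using hex
  set S : ℕ → ElementaryProcess F s t := fun n => G.elementary (hξ n) (hbd n) ht.1 with hS
  set Z : Ω → ℝ := fun ω => G.limit W b σ x t ω - x - ∫ r in s..t, b (G.limit W b σ x r ω, u r)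
    with hZ
  have hε : Tendsto (fun n : ℕ => ENNReal.ofReal (1 / ((n : ℝ) + 1))) atTop (𝓝 0) := by
    simpa using ENNReal.tendsto_ofReal tendsto_one_div_add_atTop_nhds_zero_nat
  have hdouble : ∀ {f g : ℕ → ℝ≥0∞}, Tendsto f atTop (𝓝 0) → Tendsto g atTop (𝓝 0) →
      Tendsto (fun n => 2 * f n + 2 * g n) atTop (𝓝 0) := fun hf hg => by
    simpa using (ENNReal.Tendsto.const_mul hf (Or.inr ENNReal.ofNat_ne_top)).add
      (ENNReal.Tendsto.const_mul (a := 2) hg (Or.inr ENNReal.ofNat_ne_top))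
  have hma : ∀ {ψ}, LipschitzWith K ψ → ∀ n, Measurable (fun p : Ω × ℝ =>
      ψ (G.limit W b σ x p.2 p.1, u p.2) - G.approx W b σ x ψ n t p.2 p.1) := fun hψ n =>
    ((G.measurable_comp_limit hW hs hb hσ hψ).sub
      (G.measurable_approx hW hs hb hσ hψ n t)).comp measurable_swap
  have hpath : Tendsto (fun n => ∫⁻ ω, (∫⁻ r in Icc s t, ‖σ (G.limit W b σ x r ω, u r)
      - (S n).path r ω‖ₑ ^ 2) ∂P) atTop (𝓝 0) := by
    refine tendsto_of_tendsto_of_tendsto_of_le_of_le tendsto_const_nhds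
      (hdouble (G.tendsto_lintegral_limit_sub_approx (x := x) hW hs hb hσ hσ ht) hε)
      (fun _ => zero_le) fun n => ?_
    have hme := (((hma hσ n).enorm).pow_const 2)
    calc _ ≤ ∫⁻ ω, (∫⁻ r in Icc s t, (2 * ‖σ (G.limit W b σ x r ω, u r)
          - G.approx W b σ x σ n t r ω‖ₑ ^ 2
          + 2 * ‖G.approx W b σ x σ n t r ω - (S n).path r ω‖ₑ ^ 2)) ∂P := by
          refine lintegral_mono fun ω => lintegral_mono fun r => ?_
          rw [← sub_add_sub_cancel _ (G.approx W b σ x σ n t r ω)]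
          exact enorm_add_sq_le _ _
      _ = 2 * ∫⁻ ω, (∫⁻ r in Icc s t, ‖σ (G.limit W b σ x r ω, u r)
          - G.approx W b σ x σ n t r ω‖ₑ ^ 2) ∂P
          + 2 * ∫⁻ ω, (∫⁻ r in Icc s t, ‖G.approx W b σ x σ n t r ω
            - (S n).path r ω‖ₑ ^ 2) ∂P := by
          rw [← lintegral_const_mul' _ _ ENNReal.ofNat_ne_top,
            ← lintegral_const_mul' _ _ ENNReal.ofNat_ne_top,
            ← lintegral_add_left (hme.lintegral_prod_right'.const_mul 2)]
          refine lintegral_congr fun ω => ?_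
          have hmω : Measurable (fun r => ‖σ (G.limit W b σ x r ω, u r)
              - G.approx W b σ x σ n t r ω‖ₑ ^ 2) := hme.comp measurable_prodMk_left
          rw [lintegral_add_left (hmω.const_mul 2), lintegral_const_mul' _ _ ENNReal.ofNat_ne_top,
            lintegral_const_mul' _ _ ENNReal.ofNat_ne_top]
      _ ≤ _ := by
          gcongr
          rw [hS, G.lintegral_approx_sub_elementary (hξ n) (hbd n) ht.1 (hcoef n)]
          exact ENNReal.ofReal_le_ofReal (hξe n)
  have hXm : Measurable (G.limit W b σ x t) :=
    (G.measurable_filtration_limit hW hs hb hσ ht.1).mono (F.le t) le_rfl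
  have hZm : Measurable Z := by
    refine (hXm.sub_const x).sub ?_
    simp_rw [intervalIntegral.integral_of_le ht.1]
    exact ((G.measurable_comp_limit hW hs hb hσ hb).stronglyMeasurable.integral_prod_left').measurable
  obtain ⟨C, hC0, hC⟩ := G.exists_eLpNorm_limit_sub_le hW hs hb hσ x
  have hr1 : √(1 / 2 : ℝ) < 1 := by rw [Real.sqrt_lt' one_pos]; norm_num
  have hX : Tendsto (fun n => ∫⁻ ω, ‖G.limit W b σ x t ω
      - G.euler W b σ x n (G.idx n t) ω‖ₑ ^ 2 ∂P) atTop (𝓝 0) := by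
    have h1 : Tendsto (fun n : ℕ => C * √(1 / 2) ^ n) atTop (𝓝 0) := by
      simpa using (tendsto_pow_atTop_nhds_zero_of_lt_one (Real.sqrt_nonneg _) hr1).const_mul C
    have h2 := (ENNReal.continuous_pow 2).tendsto _ |>.comp (ENNReal.tendsto_ofReal h1)
    have h3 : Tendsto (fun n : ℕ => ENNReal.ofReal (C * √(1 / 2) ^ n) ^ 2) atTop (𝓝 0) := by
      simpa [Function.comp_def] using h2
    refine tendsto_of_tendsto_of_tendsto_of_le_of_le tendsto_const_nhds h3
      (fun _ => zero_le) fun n => ?_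
    simp only
    rw [lintegral_enorm_sq_eq_eLpNorm_sq]
    exact pow_le_pow_left₀ zero_le (hC n t ht) 2
  have hdrift : Tendsto (fun n => ∫⁻ ω, ‖∫ r in s..t, (b (G.limit W b σ x r ω, u r)
      - G.approx W b σ x b n t r ω)‖ₑ ^ 2 ∂P) atTop (𝓝 0) := by
    have h1 := ENNReal.Tendsto.const_mul (a := ENNReal.ofReal (t - s))
      (G.tendsto_lintegral_limit_sub_approx (x := x) hW hs hb hσ hb ht)
      (Or.inr ENNReal.ofReal_ne_top)
    rw [mul_zero] at h1
    refine tendsto_of_tendsto_of_tendsto_of_le_of_le tendsto_const_nhds h1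
      (fun _ => zero_le) fun n => ?_
    simp only
    rw [← lintegral_const_mul' _ _ ENNReal.ofReal_ne_top]
    exact lintegral_mono fun ω => enorm_intervalIntegral_sq_le ht.1
      ((hma hb n).comp measurable_prodMk_left)
  have hint : Tendsto (fun n => ∫⁻ ω, ‖Z ω - (S n).integral W ω‖ₑ ^ 2 ∂P) atTop (𝓝 0) := by
    refine tendsto_of_tendsto_of_tendsto_of_le_of_le tendsto_const_nhds
      (hdouble hX (hdouble hdrift hε)) (fun _ => zero_le) fun n => ?_
    have hEm : Measurable (fun ω => ‖G.limit W b σ x t ω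
        - G.euler W b σ x n (G.idx n t) ω‖ₑ ^ 2) :=
      ((hXm.sub (((G.gridAdapted_euler hW hs hb hσ n).meas _).mono
        (F.le _) le_rfl)).enorm).pow_const 2
    have hDm : Measurable (fun ω => ‖∫ r in s..t, (b (G.limit W b σ x r ω, u r)
        - G.approx W b σ x b n t r ω)‖ₑ ^ 2) := by
      simp_rw [intervalIntegral.integral_of_le ht.1]
      exact (((hma hb n).stronglyMeasurable.integral_prod_right').measurable.enorm).pow_const 2
    calc _ ≤ ∫⁻ ω, (2 * ‖G.limit W b σ x t ω - G.euler W b σ x n (G.idx n t) ω‖ₑ ^ 2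
          + 2 * (2 * ‖∫ r in s..t, (b (G.limit W b σ x r ω, u r)
            - G.approx W b σ x b n t r ω)‖ₑ ^ 2
          + 2 * ‖gridSum W (G.t n) 0 (G.coef W b σ x σ n) (G.idx n t) ω
            - gridSum W (G.t n) 0 (ξ n) (G.idx n t) ω‖ₑ ^ 2)) ∂P := by
          refine lintegral_mono_ae ?_
          filter_upwards [G.ae_intervalIntegrable_comp_limit (x := x) hW hs hb hσ ht] with ω hω
          obtain ⟨hai, ha⟩ := G.integral_approx (W := W) (b := b) (σ := σ) (x := x) (ψ := b) n
            ht.1 ω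
          have hEu := G.euler_eq (W := W) (b := b) (σ := σ) (x := x) n (G.idx n t) ω
          rw [gridSum_split, ← ha] at hEu
          -- Three errors: of the state, of the integrated drift, and of the truncation under the
          -- stochastic integral. Each tends to zero in `L²`.
          have hsplit : Z ω - (S n).integral W ω
              = (G.limit W b σ x t ω - G.euler W b σ x n (G.idx n t) ω)
              + (-(∫ r in s..t, (b (G.limit W b σ x r ω, u r)
                - G.approx W b σ x b n t r ω))
              + (gridSum W (G.t n) 0 (G.coef W b σ x σ n) (G.idx n t) ω
                - gridSum W (G.t n) 0 (ξ n) (G.idx n t) ω)) := by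
            rw [intervalIntegral.integral_sub hω hai, hEu, hS, G.elementary_integral, hZ]
            ring
          rw [hsplit]
          refine (enorm_add_sq_le _ _).trans ?_
          gcongr
          refine (enorm_add_sq_le _ _).trans ?_
          rw [enorm_neg]
      _ = 2 * ∫⁻ ω, ‖G.limit W b σ x t ω - G.euler W b σ x n (G.idx n t) ω‖ₑ ^ 2 ∂P
          + 2 * (2 * ∫⁻ ω, ‖∫ r in s..t, (b (G.limit W b σ x r ω, u r)
            - G.approx W b σ x b n t r ω)‖ₑ ^ 2 ∂P
          + 2 * ∫⁻ ω, ‖gridSum W (G.t n) 0 (G.coef W b σ x σ n) (G.idx n t) ω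
            - gridSum W (G.t n) 0 (ξ n) (G.idx n t) ω‖ₑ ^ 2 ∂P) := by
          rw [lintegral_add_left (hEm.const_mul 2), lintegral_const_mul' _ _ ENNReal.ofNat_ne_top,
            lintegral_const_mul' _ _ ENNReal.ofNat_ne_top, lintegral_add_left (hDm.const_mul 2),
            lintegral_const_mul' _ _ ENNReal.ofNat_ne_top,
            lintegral_const_mul' _ _ ENNReal.ofNat_ne_top]
      _ ≤ _ := by
          gcongr
          rw [G.lintegral_gridSum_sub_sq hW hs (hcoef n) (hξ n)]
          exact ENNReal.ofReal_le_ofReal (hξe n)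
  refine ⟨⟨hZm.aestronglyMeasurable, ?_⟩, S, hpath, hint⟩
  -- `Z` lies at finite `L²` distance from one square integrable elementary integral, hence is
  -- itself square integrable.
  obtain ⟨n, hn⟩ := (hint.eventually (gt_mem_nhds one_pos)).exists
  have hSn := (S n).memLp_integral hW hs ht.2
  have hdiff : MemLp (fun ω => Z ω - (S n).integral W ω) 2 P := by
    refine ⟨hZm.aestronglyMeasurable.sub hSn.aestronglyMeasurable, ?_⟩
    rw [eLpNorm_two_eq_lintegral_rpow]
    exact ENNReal.rpow_lt_top_of_nonneg (by norm_num) (hn.trans ENNReal.one_lt_top).ne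
  have := hdiff.add hSn
  refine (eLpNorm_congr_ae (ae_of_all _ fun ω => ?_)).trans_lt this.2
  simp

end StepGrid

end

/-! ### Grids adapted to a jump, and existence of solutions -/

section

variable {Ω : Type*} [mΩ : MeasurableSpace Ω]

namespace StepGrid

/-- The piecewise linear map of `[0, 2]` onto `[s, T]` sending `0, 1, 2` to `s, q, T`. -/
def reparam (s q T r : ℝ) : ℝ := s + min r 1 * (q - s) + (min (max r 1) 2 - 1) * (T - q)

section Reparam

variable {s q T : ℝ} (hsq : s ≤ q) (hqT : q ≤ T)

include hsq hqT

lemma reparam_mono : Monotone (reparam s q T) := fun a b hab => by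
  have h1 : min a 1 ≤ min b 1 := min_le_min_right _ hab
  have h2 : min (max a 1) 2 ≤ min (max b 1) 2 := min_le_min_right _ (max_le_max_right _ hab)
  have h3 := mul_le_mul_of_nonneg_right h1 (sub_nonneg.2 hsq)
  have h4 := mul_le_mul_of_nonneg_right (sub_le_sub_right h2 1) (sub_nonneg.2 hqT)
  unfold reparam
  linarith

/-- Both clamped terms are `1`-Lipschitz, and their slopes `q - s` and `T - q` add up to `T - s`. -/
lemma reparam_sub_le {a b : ℝ} (hab : a ≤ b) :
    reparam s q T b - reparam s q T a ≤ (T - s) * (b - a) := by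
  have h1 : min b 1 - min a 1 ≤ b - a := by
    rcases le_total b 1 with h | h
    · rw [min_eq_left h, min_eq_left (hab.trans h)]
    · rw [min_eq_right h]
      rcases le_total a 1 with h' | h'
      · rw [min_eq_left h']; linarith
      · rw [min_eq_right h']; linarith
  have h2 : min (max b 1) 2 - min (max a 1) 2 ≤ b - a := by
    have h3 : max b 1 - max a 1 ≤ b - a := by
      rcases le_total b 1 with h | h
      · rw [max_eq_right h, max_eq_right (hab.trans h)]; linarith
      · rw [max_eq_left h]
        linarith [le_max_left a 1]
    rcases le_total (max a 1) 2 with h | h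
    · rw [min_eq_left h]
      linarith [min_le_left (max b 1) 2]
    · rw [min_eq_right h]
      linarith [min_le_right (max b 1) 2]
  have h3 := mul_le_mul_of_nonneg_right h1 (sub_nonneg.2 hsq)
  have h4 := mul_le_mul_of_nonneg_right h2 (sub_nonneg.2 hqT)
  unfold reparam
  linarith

omit hsq hqT

lemma reparam_zero : reparam s q T 0 = s := by norm_num [reparam]

lemma reparam_one : reparam s q T 1 = q := by norm_num [reparam]

lemma reparam_of_two_le {r : ℝ} (hr : 2 ≤ r) : reparam s q T r = T := by
  rw [reparam, min_eq_right (by linarith), max_eq_left (by linarith), min_eq_right hr]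
  ring

end Reparam

/-- The grids adapted to a function jumping from `0` to `m` at time `τ`. -/
def switch {s T : ℝ} (hsT : s ≤ T) (τ m : ℝ) :
    StepGrid s T (fun r => if r ≤ τ then 0 else m) where
  -- The jump time clamped to `[s, T]` is the image of `1`, hence a point of every grid. If the jump
  -- falls outside the interval, one half of the cells degenerates.
  t n i := reparam s (max s (min τ T)) T ((i : ℝ) / 2 ^ n)
  v n i := if i < 2 ^ n then 0 else m
  bound := |m|
  mono n i j hij := reparam_mono (le_max_left _ _) (max_le hsT (min_le_right _ _)) (by gcongr)
  zero n := by simp [reparam_zero]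
  last n i hi := by
    refine reparam_of_two_le ?_
    rw [le_div_iff₀ (by positivity), ← pow_succ']
    exact_mod_cast hi
  refine n i := by
    congr 1
    rw [pow_succ']
    push_cast
    exact mul_div_mul_left _ _ two_ne_zero
  mesh n i := by
    refine (reparam_sub_le (le_max_left _ _) (max_le hsT (min_le_right _ _))
      (by push_cast; gcongr; linarith)).trans (le_of_eq ?_)
    push_cast
    rw [← sub_div, add_sub_cancel_left, one_div_pow]
  v_refine n i := by
    have : i < 2 ^ (n + 1) ↔ i / 2 < 2 ^ n := by
      rw [Nat.div_lt_iff_lt_mul two_pos, pow_succ]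
    simp only [this]
  v_eq n i r hr := by
    have hqT : max s (min τ T) ≤ T := max_le hsT (min_le_right _ _)
    have hmono := reparam_mono (le_max_left s (min τ T)) hqT
    by_cases hi : i < 2 ^ n
    · have h1 : reparam s (max s (min τ T)) T (((i + 1 : ℕ) : ℝ) / 2 ^ n) ≤ max s (min τ T) := by
        refine (hmono ?_).trans_eq reparam_one
        rw [div_le_one (by positivity)]
        exact_mod_cast hi
      have h2 : s ≤ reparam s (max s (min τ T)) T ((i : ℝ) / 2 ^ n) := by
        conv_lhs => rw [← reparam_zero (s := s) (q := max s (min τ T)) (T := T)]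
        exact hmono (by positivity)
      -- `r` lies in a half-open cell, so `r > s`. This rules out the first alternative in `r ≤ max
      -- s (min τ T)`.
      have h3 : r ≤ min τ T := (le_max_iff.1 (hr.2.trans h1)).resolve_left
        (not_le.2 (h2.trans_lt hr.1))
      rw [if_pos hi, if_pos (h3.trans (min_le_left _ _))]
    · have h1 : max s (min τ T) ≤ reparam s (max s (min τ T)) T ((i : ℝ) / 2 ^ n) := by
        conv_lhs => rw [← reparam_one (s := s) (q := max s (min τ T)) (T := T)]
        refine hmono ?_
        rw [one_le_div (by positivity)]
        exact_mod_cast not_lt.1 hi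
      have h2 : r ≤ T := hr.2.trans ((hmono (le_max_left _ 2)).trans_eq
        (reparam_of_two_le (le_max_right _ _)))
      have h3 : ¬ r ≤ τ := fun h =>
        absurd (((le_max_right _ _).trans h1).trans_lt hr.1) (not_lt.2 (le_min h h2))
      rw [if_neg hi, if_neg h3]
  abs_v_le n i := by split_ifs <;> simp
  abs_le r := by split_ifs <;> simp
  measurable := Measurable.ite measurableSet_Iic measurable_const measurable_const

variable {P : Measure Ω} [IsProbabilityMeasure P] {F : Filtration ℝ mΩ} {T : ℝ} {W : ℝ → Ω → ℝ}
  {s : ℝ} {u : ℝ → ℝ} (G : StepGrid s T u)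

attribute [local irreducible] limit

/-- The limit of the Euler schemes solves the state equation. -/
lemma isState_limit (hW : IsBrownianOn P F T W) (hs : 0 ≤ s) {b σ : ℝ × ℝ → ℝ} {K : NNReal}
    {ρ : ℝ} (hρ : ∀ p, b p = -ρ * p.1 + p.2) (hb : LipschitzWith K b) (hσ : LipschitzWith K σ)
    (x : ℝ) : IsState P F W T ρ σ s x (fun t _ => u t) (G.limit W b σ x) where
  measAdapted := G.isMeasurableAdapted_limit hW hs hb hσ
  continuous := (G.ae_continuousOn_limit hW hs hb hσ x).mono fun _ h => h.1
  sqIntegrable := by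
    obtain ⟨C, hC, h⟩ := G.exists_lintegral_limit_sq_le hW hs hb hσ x
    have hm : Measurable (fun p : ℝ × Ω => ‖G.limit W b σ x p.1 p.2‖ₑ ^ 2) :=
      (G.measurable_limit hW hs hb hσ).enorm.pow_const 2
    have hswap : ∫⁻ ω, (∫⁻ t in Icc s T, ‖G.limit W b σ x t ω‖ₑ ^ 2) ∂P
        = ∫⁻ t in Icc s T, ∫⁻ ω, ‖G.limit W b σ x t ω‖ₑ ^ 2 ∂P :=
      (lintegral_lintegral_swap hm.aemeasurable).symm
    rw [hswap]
    refine (setLIntegral_mono measurable_const h).trans_lt ?_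
    rw [setLIntegral_const, Real.volume_Icc]
    finiteness
  equation t ht := by
    refine ⟨_, G.isItoIntegral_limit (x := x) hW hs hb hσ ht, ae_of_all _ fun ω => ?_⟩
    simp only [hρ]
    ring

end StepGrid

/-- The state equation has a solution for every control jumping from `0` to `m`. -/
theorem exists_isState {P : Measure Ω} [IsProbabilityMeasure P] {F : Filtration ℝ mΩ} {T : ℝ}
    {W : ℝ → Ω → ℝ} (hW : IsBrownianOn P F T W) {σ : ℝ × ℝ → ℝ} {K : NNReal}
    (hσ : LipschitzWith K σ) {s : ℝ} (hs : s ∈ Icc 0 T) (ρ x τ m : ℝ) :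
    ∃ X, IsState P F W T ρ σ s x (fun t _ => if t ≤ τ then 0 else m) X := by
  have hb : LipschitzWith (‖-ρ‖₊ * 1 + 1) (fun p : ℝ × ℝ => -ρ * p.1 + p.2) :=
    ((lipschitzWith_smul (-ρ)).comp LipschitzWith.prod_fst).add LipschitzWith.prod_snd
  exact ⟨_, (StepGrid.switch hs.2 τ m).isState_limit hW hs.1 (fun _ => rfl)
    (hb.weaken (le_max_left _ K)) (hσ.weaken (le_max_right _ _)) x⟩

end

end Goodwill

end

/-! ### The main theorem -/

theorem mainTheorem2 {Ω : Type*} [mΩ : MeasurableSpace Ω] (P : Measure Ω) [IsProbabilityMeasure P]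
    (F : Filtration ℝ mΩ) (W : ℝ → Ω → ℝ) (T ρ c γ₀ γ m : ℝ)
    (hT : 0 < T) (hρ : 0 < ρ) (hc : 0 < c) (hγ₀ : 0 < γ₀) (hm : 0 ≤ m)
    (hγ : γ = γ₀ * Real.exp (-c * T))
    (hW : Goodwill.IsBrownianOn P F T W)
    (σ : ℝ × ℝ → ℝ) (hσ : ∃ K : NNReal, LipschitzWith K σ) :
    -- the expectation defining the performance is finite for every admissible control
    (∀ s ∈ Icc 0 T, ∀ x : ℝ, ∀ a ∈ ({0, s} : Set ℝ), ∀ u X : ℝ → Ω → ℝ,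
      Goodwill.IsControl F T m u → Goodwill.IsState P F W T ρ σ s x u X →
      Integrable (Goodwill.reward T c γ a u X) P) ∧
    -- the bang-bang policy is admissible and optimal from time 0
    Goodwill.IsControl F T m (fun t _ => Goodwill.bangBang T ρ c γ m t) ∧
    (∀ x : ℝ,
      (∃ X, Goodwill.IsState P F W T ρ σ 0 x (fun t _ => Goodwill.bangBang T ρ c γ m t) X) ∧
      ∀ X, Goodwill.IsState P F W T ρ σ 0 x (fun t _ => Goodwill.bangBang T ρ c γ m t) X →
        ∀ u Y : ℝ → Ω → ℝ, Goodwill.IsControl F T m u → Goodwill.IsState P F W T ρ σ 0 x u Y →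
          Goodwill.performance P T c γ 0 u Y ≤
            Goodwill.performance P T c γ 0 (fun t _ => Goodwill.bangBang T ρ c γ m t) X) ∧
    -- the value function, whether the cost is accumulated from time `0` or from time `s`
    (∀ s ∈ Icc 0 T, ∀ x : ℝ, ∀ a ∈ ({0, s} : Set ℝ),
      IsLUB (Goodwill.performanceValues P F W T ρ c γ m σ a s x)
        (Goodwill.slope T ρ γ s * x + Goodwill.intercept T ρ c γ m s)) := by
  obtain ⟨K, hK⟩ := hσ
  have hγ' : 0 < γ := hγ ▸ mul_pos hγ₀ (Real.exp_pos _)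
  refine ⟨fun s hs x a ha u X hu hX => ?_, Goodwill.isControl_ite hm, fun x => ⟨?_, ?_⟩,
    fun s hs x a ha => ⟨?_, fun B hB => ?_⟩⟩
  · have haT : a ∈ Icc 0 T := by
      rcases ha with rfl | rfl
      exacts [⟨le_rfl, hT.le⟩, hs]
    exact hX.integrable_reward hW hs.1 hs.2 haT.1 haT.2 hu
  · exact Goodwill.exists_isState hW hK ⟨le_rfl, hT.le⟩ ρ x _ m
  · intro X hX u Y hu hY
    -- The bound for arbitrary controls is attained by every solution `X` under the bang-bang
    -- control.
    refine (hY.performance_le hW hρ hc hγ' hT.le le_rfl le_rfl hu).trans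
      (Goodwill.IsState.performance_bangBang hW hρ hc hT.le le_rfl le_rfl hm (fun _ _ => Iff.rfl)
        (fun t ht => absurd ht.1 (not_lt.2 ht.2)) hX).ge
  · rintro J ⟨u, X, hu, hX, rfl⟩
    have ha' : a ∈ Icc 0 s := by
      rcases ha with rfl | rfl
      exacts [⟨le_rfl, hs.1⟩, ⟨hs.1, le_rfl⟩]
    exact hX.performance_le hW hρ hc hγ' hs.2 ha'.1 ha'.2 hu
  · have ha' : a ∈ Icc 0 s := by
      rcases ha with rfl | rfl
      exacts [⟨le_rfl, hs.1⟩, ⟨hs.1, le_rfl⟩]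
    -- Switching at `max s t_*` keeps the control at zero up to `s`, so nothing is paid on `[a, s]`,
    -- and follows the bang-bang policy afterwards. The supremum is thus attained for both choices
    -- of `a`.
    obtain ⟨X, hX⟩ := Goodwill.exists_isState hW hK hs ρ x
      (max s (Goodwill.switchTime T ρ c γ)) m
    refine hB ⟨_, X, Goodwill.isControl_ite hm, hX, ?_⟩
    exact (Goodwill.IsState.performance_bangBang hW hρ hc hs.2 ha'.1 ha'.2 hm
      (fun t ht => by rw [le_max_iff, or_iff_right (not_le.2 ht)])
      (fun t ht => le_max_of_le_left ht.2) hX).symm
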